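/- **Setting.** Let $X_t\in\mathbb R^d$ and $\eta_t\in\mathbb R^q$ ($t=1,2,\dots$) be random vectors on a probability space, let $\mathcal F_t=\sigma\{\eta_1,\dots,\eta_{t-1},X_1,\dots,X_t\}$ (with $\mathcal F_0$ trivial), and let $Y_t=A_*X_t+\eta_t$ for $t=1,\dots,n$, where $A_*\in\mathbb R^{q\times d}$. Put $N=qd$ and $\beta_*=\mathrm{vec}(A_*^{\mathsf T})\in\mathbb R^N$, and suppose that $\mathcal C\beta_*=\mu$, where $\mathcal C$ is a known $(N-m)\times N$ matrix of rank $N-m$ and $\mu\in\mathbb R^{N-m}$ is known. Let $\mathcal C_+$ be an $m\times N$ matrix such that $\mathcal C_{\rm full}=(\mathcal C_+^{\mathsf T},\mathcal C^{\mathsf T})^{\mathsf T}$ is invertible, write $\mathcal C_{\rm full}^{-1}=(R,R_+)$ with $R\in\mathbb R^{N\times m}$, and set $\gamma=R_+\mu$, so that $\{\beta:\mathcal C\beta=\mu\}=\{R\theta+\gamma:\theta\in\mathbb R^m\}$. Partition $R=(R_1^{\mathsf T},\dots,R_q^{\mathsf T})^{\mathsf T}$ into $d\times m$ blocks $R_i$.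 With $X=(X_1,\dots,X_n)^{\mathsf T}$, $Y=(Y_1,\dots,Y_n)^{\mathsf T}$ and $Z=(I_q\otimes X)R$, let $$\widehat\theta\in\arg\min_{\theta\in\mathbb R^m}\bigl\|\mathrm{vec}(Y)-(I_q\otimes X)\gamma-Z\theta\bigr\|^2,$$ and let the ordinary least squares estimator $\widehat A\in\mathbb R^{q\times d}$ be given by $\mathrm{vec}(\widehat A^{\mathsf T})=R\widehat\theta+\gamma$. For a $d\times d$ matrix $\Gamma$ write $\Gamma_R=R^{\mathsf T}(I_q\otimes\Gamma)R$; let $\preceq$ be the Loewner order on symmetric matrices. **Proposition.** Let $\delta\in(0,1)$ and $\sigma>0$, let $\Gamma_{\rm sb},\overline\Gamma$ be symmetric $d\times d$ matrices with $0\prec\Gamma_{\rm sb}\preceq\overline\Gamma$, and put $\underline\Gamma_R=R^{\mathsf T}(I_q\otimes\Gamma_{\rm sb})R$, $\overline\Gamma_R=R^{\mathsf T}(I_q\otimes\overline\Gamma)R$. Suppose that: 1. $\{X_t\}$ satisfies the $(k,\Gamma_{\rm sb},\alpha)$ block martingale small ball condition, where $k\ge1$ is an integer and $\alpha\in(0,1)$: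 for every unit vector $\omega\in\mathbb R^d$ and every integer $s\ge0$, $$\frac1k\sum_{t=1}^k\Pr\bigl(|\omega^{\mathsf T}X_{s+t}|\ge(\omega^{\mathsf T}\Gamma_{\rm sb}\,\omega)^{1/2}\mid\mathcal F_s\bigr)\ge\alpha\quad\text{almost surely};$$ 2. $\Pr(Z^{\mathsf T}Z\npreceq n\overline\Gamma_R)\le\delta$; 3. for every $t\ge1$, $\eta_t$ given $\mathcal F_t$ is mean-zero and $\sigma^2$-sub-Gaussian: $E(\eta_t\mid\mathcal F_t)=0$ and $E(e^{l u^{\mathsf T}\eta_t}\mid\mathcal F_t)\le e^{\sigma^2l^2/2}$ almost surely for every unit vector $u\in\mathbb R^q$ and every $l\in\mathbb R$; 4. $\displaystyle n\ge\frac{9k}{\alpha^2}\Bigl\{m\log\frac{27}{\alpha}+\frac12\log\det(\overline\Gamma_R\underline\Gamma_R^{-1})+\log q+\log\frac1\delta\Bigr\}.$ Then, with probability at least $1-3\delta$, the spectral norm of the estimation error satisfies $$\|\widehat A-A_*\|_2\le\frac{9\sigma}{\alpha}\left[\frac{\lambda_{\max}\bigl(\sum_{i=1}^qR_i\underline\Gamma_R^{-1}R_i^{\mathsf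 T}\bigr)}{n}\Bigl\{12m\log\frac{14}{\alpha}+9\log\det(\overline\Gamma_R\underline\Gamma_R^{-1})+6\log\frac1\delta\Bigr\}\right]^{1/2}.$$ -/

import Mathlib

open MeasureTheory
open scoped Matrix Kronecker Matrix.Norms.L2Operator

noncomputable section

namespace RestrictedRegression

/-- The information available at time `t`: the σ-algebra generated by `η_1, …, η_{t-1}` and
`X_1, …, X_t`. At time `0` it is the trivial σ-algebra. -/
abbrev history {Ω : Type*} {d q : ℕ} (X : ℕ → Ω → Fin d → ℝ) (η : ℕ → Ω → Fin q → ℝ) (t : ℕ) :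
    MeasurableSpace Ω :=
  (⨆ s : {s : ℕ // 1 ≤ s ∧ s < t}, MeasurableSpace.comap (η s) inferInstance) ⊔
    (⨆ s : {s : ℕ // 1 ≤ s ∧ s ≤ t}, MeasurableSpace.comap (X s) inferInstance)

/-- The conditional probability `P(B | m)`: the conditional expectation of the indicator of `B`. -/
def condProb {Ω : Type*} [MeasurableSpace Ω] (P : Measure Ω) (m : MeasurableSpace Ω) (B : Set Ω) :
    Ω → ℝ :=
  P[B.indicator (fun _ => (1 : ℝ)) | m]

/-- The `(k, ν, α)` block martingale small ball condition for a real-valued time series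
`x_1, x_2, …` adapted to `F`. -/
def ScalarBMSB {Ω : Type*} [MeasurableSpace Ω] (P : Measure Ω) (F : ℕ → MeasurableSpace Ω)
    (x : ℕ → Ω → ℝ) (k : ℕ) (ν α : ℝ) : Prop :=
  1 ≤ k ∧ 0 < ν ∧ 0 < α ∧ α < 1 ∧
  (∀ t : ℕ, 1 ≤ t → Measurable[F t] (x t)) ∧
  ∀ s : ℕ, ∀ᵐ ω ∂P,
    α ≤ (k : ℝ)⁻¹ * ∑ t ∈ Finset.Icc 1 k, condProb P (F s) {ω' | ν ≤ |x (s + t) ω'|} ω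

/-- The `(k, Γ, α)` block martingale small ball condition for an `ℝ^d`-valued time series:
`Γ` is positive definite and, for every unit vector `u`, the series `uᵀ X_t` satisfies the
`(k, (uᵀ Γ u)^{1/2}, α)` condition. -/
def BMSB {Ω : Type*} [MeasurableSpace Ω] {d : ℕ} (P : Measure Ω) (F : ℕ → MeasurableSpace Ω)
    (X : ℕ → Ω → Fin d → ℝ) (k : ℕ) (Γ : Matrix (Fin d) (Fin d) ℝ) (α : ℝ) : Prop :=
  1 ≤ k ∧ 0 < α ∧ α < 1 ∧ Γ.PosDef ∧
  ∀ u : Fin d → ℝ, u ⬝ᵥ u = 1 →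
    ScalarBMSB P F (fun t ω => u ⬝ᵥ X t ω) k (Real.sqrt (u ⬝ᵥ (Γ *ᵥ u))) α

/-- Conditionally on `m`, the random vector `ξ` is mean-zero and `σ²`-sub-Gaussian:
`E(ξ | m) = 0`, and `E(exp(l uᵀξ) | m) ≤ exp(σ² l² / 2)` for all unit vectors `u` and all real
`l`. -/
def CondSubGaussian {Ω : Type*} [MeasurableSpace Ω] {q : ℕ} (P : Measure Ω)
    (m : MeasurableSpace Ω) (ξ : Ω → Fin q → ℝ) (σ : ℝ) : Prop :=
  Integrable ξ P ∧ P[ξ | m] =ᵐ[P] 0 ∧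
  ∀ u : Fin q → ℝ, u ⬝ᵥ u = 1 → ∀ l : ℝ,
    Integrable (fun ω => Real.exp (l * (u ⬝ᵥ ξ ω))) P ∧
    P[fun ω => Real.exp (l * (u ⬝ᵥ ξ ω)) | m] ≤ᵐ[P] fun _ => Real.exp (σ ^ 2 * l ^ 2 / 2)

/-- Linear restrictions `C β = μ` on `β = vec(Aᵀ) ∈ ℝ^{qd}`, `A` a `q × d` matrix. `C` has `r` rows
and `Cplus` is a complement of `C` with `m` rows, such that the stacked matrix `(Cplus; C)` is
invertible (which forces `r = qd - m` and `rank C = r`); `(R, Rplus)` is its inverse, where `R`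
has `m` columns. Coordinate `(i, j)` of `ℝ^{qd}` is the `j`-th coordinate of the `i`-th block of
length `d`. -/
structure LinearRestriction (q d m r : ℕ) where
  C : Matrix (Fin r) (Fin q × Fin d) ℝ
  μ : Fin r → ℝ
  Cplus : Matrix (Fin m) (Fin q × Fin d) ℝ
  R : Matrix (Fin q × Fin d) (Fin m) ℝ
  Rplus : Matrix (Fin q × Fin d) (Fin r) ℝ
  full_mul_inv : Matrix.fromRows Cplus C * Matrix.fromCols R Rplus = 1
  inv_mul_full : Matrix.fromCols R Rplus * Matrix.fromRows Cplus C = 1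

namespace LinearRestriction

variable {q d m r : ℕ}

/-- The shift `γ = Rplus μ`. -/
def γ (L : LinearRestriction q d m r) : Fin q × Fin d → ℝ := L.Rplus *ᵥ L.μ

/-- The matrix `A` satisfies the restrictions: `C vec(Aᵀ) = μ`. -/
def Holds (L : LinearRestriction q d m r) (A : Matrix (Fin q) (Fin d) ℝ) : Prop :=
  L.C *ᵥ Matrix.vec Aᵀ = L.μ

/-- The `i`-th `d × m` block `R_i` of `R = (R_1; …; R_q)`. -/
def block (L : LinearRestriction q d m r) (i : Fin q) : Matrix (Fin d) (Fin m) ℝ :=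
  L.R.submatrix (fun j => (i, j)) id

/-- `Γ_R = Rᵀ (I_q ⊗ Γ) R`. -/
def restrict (L : LinearRestriction q d m r) (Γ : Matrix (Fin d) (Fin d) ℝ) :
    Matrix (Fin m) (Fin m) ℝ :=
  L.Rᵀ * ((1 : Matrix (Fin q) (Fin q) ℝ) ⊗ₖ Γ) * L.R

/-- The design matrix `Z = (I_q ⊗ X) R` of the reparameterized regression. -/
def design {n : ℕ} (L : LinearRestriction q d m r) (X : Matrix (Fin n) (Fin d) ℝ) :
    Matrix (Fin q × Fin n) (Fin m) ℝ :=
  ((1 : Matrix (Fin q) (Fin q) ℝ) ⊗ₖ X) * L.R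

/-- The shifted response `vec(Y) - (I_q ⊗ X) γ`. -/
def response {n : ℕ} (L : LinearRestriction q d m r) (X : Matrix (Fin n) (Fin d) ℝ)
    (Y : Matrix (Fin n) (Fin q) ℝ) : Fin q × Fin n → ℝ :=
  Matrix.vec Y - ((1 : Matrix (Fin q) (Fin q) ℝ) ⊗ₖ X) *ᵥ L.γ

/-- The residual sum of squares at the parameter `θ`. -/
def rss {n : ℕ} (L : LinearRestriction q d m r) (X : Matrix (Fin n) (Fin d) ℝ)
    (Y : Matrix (Fin n) (Fin q) ℝ) (θ : Fin m → ℝ) : ℝ :=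
  ∑ p, (L.response X Y p - (L.design X *ᵥ θ) p) ^ 2

/-- `θ` is an ordinary least squares estimate: it minimizes the residual sum of squares. -/
def IsOLS {n : ℕ} (L : LinearRestriction q d m r) (X : Matrix (Fin n) (Fin d) ℝ)
    (Y : Matrix (Fin n) (Fin q) ℝ) (θ : Fin m → ℝ) : Prop :=
  ∀ θ' : Fin m → ℝ, L.rss X Y θ ≤ L.rss X Y θ'

/-- The `q × d` matrix `A` with `vec(Aᵀ) = R θ + γ`, that is, `(I_q ⊗ θᵀ) (R_1, …, R_q)ᵀ + G` with
`G = (γ_1, …, γ_q)ᵀ`. -/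
def toMatrix (L : LinearRestriction q d m r) (θ : Fin m → ℝ) : Matrix (Fin q) (Fin d) ℝ :=
  Matrix.of fun i j => (L.R *ᵥ θ + L.γ) (i, j)

end LinearRestriction

/-- The matrix with rows `v_1(ω)ᵀ, …, v_n(ω)ᵀ`. -/
def dataMatrix {Ω : Type*} {p : ℕ} (v : ℕ → Ω → Fin p → ℝ) (n : ℕ) (ω : Ω) :
    Matrix (Fin n) (Fin p) ℝ :=
  Matrix.of fun t i => v (t + 1) ω i

/-- The largest (real) eigenvalue of a square matrix. -/
def lambdaMax {d : ℕ} (A : Matrix (Fin d) (Fin d) ℝ) : ℝ := sSup (spectrum ℝ A)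

end RestrictedRegression

end

namespace RestrictedRegression

section QuadraticForm

variable {m : ℕ}

open scoped MatrixOrder in
lemma exists_transpose_mul_self {M : Matrix (Fin m) (Fin m) ℝ} (hM : M.PosSemidef) :
    ∃ B : Matrix (Fin m) (Fin m) ℝ, M = Bᵀ * B := by
  obtain ⟨B, hB⟩ := CStarAlgebra.nonneg_iff_eq_star_mul_self.mp hM.nonneg
  exact ⟨B, by rw [hB, Matrix.star_eq_conjTranspose, Matrix.conjTranspose_eq_transpose_of_trivial]⟩

lemma dotProduct_transpose_mul_self {p : Type*} [Fintype p] (B : Matrix p (Fin m) ℝ)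
    (v w : Fin m → ℝ) : v ⬝ᵥ ((Bᵀ * B) *ᵥ w) = (B *ᵥ v) ⬝ᵥ (B *ᵥ w) := by
  rw [← Matrix.mulVec_mulVec, Matrix.dotProduct_mulVec, Matrix.vecMul_transpose]

lemma quad_nonneg {M : Matrix (Fin m) (Fin m) ℝ} (hM : M.PosSemidef) (v : Fin m → ℝ) :
    0 ≤ v ⬝ᵥ (M *ᵥ v) := by
  simpa using hM.dotProduct_mulVec_nonneg v

lemma quad_pos {M : Matrix (Fin m) (Fin m) ℝ} (hM : M.PosDef) {v : Fin m → ℝ} (hv : v ≠ 0) :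
    0 < v ⬝ᵥ (M *ᵥ v) := by
  simpa using hM.dotProduct_mulVec_pos hv

lemma quad_mono {M N : Matrix (Fin m) (Fin m) ℝ} (h : (N - M).PosSemidef) (v : Fin m → ℝ) :
    v ⬝ᵥ (M *ᵥ v) ≤ v ⬝ᵥ (N *ᵥ v) := by
  have := quad_nonneg h v
  rw [Matrix.sub_mulVec, dotProduct_sub] at this
  linarith

lemma quad_smul (M : Matrix (Fin m) (Fin m) ℝ) (c : ℝ) (v : Fin m → ℝ) :
    v ⬝ᵥ ((c • M) *ᵥ v) = c * (v ⬝ᵥ (M *ᵥ v)) := by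
  rw [Matrix.smul_mulVec, dotProduct_smul, smul_eq_mul]

lemma quad_smul_vec (M : Matrix (Fin m) (Fin m) ℝ) (c : ℝ) (v : Fin m → ℝ) :
    (c • v) ⬝ᵥ (M *ᵥ (c • v)) = c ^ 2 * (v ⬝ᵥ (M *ᵥ v)) := by
  rw [Matrix.mulVec_smul, dotProduct_smul, smul_dotProduct, smul_eq_mul, smul_eq_mul]
  ring

lemma continuous_quad (M : Matrix (Fin m) (Fin m) ℝ) :
    Continuous fun v : Fin m → ℝ => v ⬝ᵥ (M *ᵥ v) := by
  fun_prop

/-- The triangle inequality for the seminorm `v ↦ (vᵀ M v)^{1/2}`. -/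
lemma sqrt_quad_add_le {M : Matrix (Fin m) (Fin m) ℝ} (hM : M.PosSemidef) (v w : Fin m → ℝ) :
    √((v + w) ⬝ᵥ (M *ᵥ (v + w))) ≤ √(v ⬝ᵥ (M *ᵥ v)) + √(w ⬝ᵥ (M *ᵥ w)) := by
  obtain ⟨B, rfl⟩ := exists_transpose_mul_self hM
  have key : ∀ u : Fin m → ℝ, √(u ⬝ᵥ ((Bᵀ * B) *ᵥ u)) = ‖WithLp.toLp 2 (B *ᵥ u)‖ := by
    intro u
    rw [dotProduct_transpose_mul_self, EuclideanSpace.norm_eq]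
    simp [dotProduct, pow_two]
  rw [key, key, key, Matrix.mulVec_add, WithLp.toLp_add]
  exact norm_add_le _ _

lemma dotProduct_sq_le {p : Type*} [Fintype p] (a b : p → ℝ) :
    (a ⬝ᵥ b) ^ 2 ≤ (a ⬝ᵥ a) * (b ⬝ᵥ b) := by
  simpa [dotProduct, pow_two] using Finset.sum_mul_sq_le_sq_mul_sq Finset.univ a b

/-- The Cauchy–Schwarz inequality in the dual norms given by `M⁻¹` and `M`. -/
lemma dotProduct_sq_le_inv {M : Matrix (Fin m) (Fin m) ℝ} (hM : M.PosDef) (a v : Fin m → ℝ) :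
    (a ⬝ᵥ v) ^ 2 ≤ (a ⬝ᵥ (M⁻¹ *ᵥ a)) * (v ⬝ᵥ (M *ᵥ v)) := by
  obtain ⟨B, hB⟩ := exists_transpose_mul_self hM.posSemidef
  have hdet : IsUnit M.det := hM.det_pos.ne'.isUnit
  set b := M⁻¹ *ᵥ a with hb
  have ha : a = M *ᵥ b := by
    rw [hb, Matrix.mulVec_mulVec, Matrix.mul_nonsing_inv _ hdet, Matrix.one_mulVec]
  rw [dotProduct_comm a v, dotProduct_comm a b, ha, hB]
  simp only [dotProduct_transpose_mul_self]
  rw [dotProduct_comm]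
  exact dotProduct_sq_le _ _

/-- Integrals of functions of a positive definite quadratic form. -/
lemma lintegral_quad {M : Matrix (Fin m) (Fin m) ℝ} (hM : M.PosDef) {φ : ℝ → ENNReal}
    (hφ : Measurable φ) :
    ∫⁻ v : Fin m → ℝ, φ (v ⬝ᵥ (M *ᵥ v)) =
      ENNReal.ofReal (√M.det)⁻¹ * ∫⁻ v : Fin m → ℝ, φ (v ⬝ᵥ v) := by
  obtain ⟨B, hB⟩ := exists_transpose_mul_self hM.posSemidef
  have hdet : M.det = B.det ^ 2 := by rw [hB, Matrix.det_mul, Matrix.det_transpose]; ring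
  have hBdet : B.det ≠ 0 := by
    intro h
    have := hM.det_pos
    rw [hdet, h] at this
    simp at this
  have hmap := Real.map_matrix_volume_pi_eq_smul_volume_pi hBdet
  have h1 : ∀ v : Fin m → ℝ, φ (v ⬝ᵥ (M *ᵥ v)) = φ (Matrix.toLin' B v ⬝ᵥ Matrix.toLin' B v) := by
    intro v
    rw [hB, dotProduct_transpose_mul_self, Matrix.toLin'_apply]
  have hc : Continuous fun w : Fin m → ℝ => w ⬝ᵥ w := by fun_prop
  simp_rw [h1]
  rw [← lintegral_map (f := fun w : Fin m → ℝ => φ (w ⬝ᵥ w)) (hφ.comp hc.measurable)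
    (LinearMap.continuous_of_finiteDimensional _).measurable, hmap, lintegral_smul_measure,
    hdet, Real.sqrt_sq_eq_abs, abs_inv, smul_eq_mul]

lemma volume_quad_le {M : Matrix (Fin m) (Fin m) ℝ} (hM : M.PosDef) :
    volume {v : Fin m → ℝ | v ⬝ᵥ (M *ᵥ v) ≤ 1} =
      ENNReal.ofReal (√M.det)⁻¹ * volume {v : Fin m → ℝ | v ⬝ᵥ v ≤ 1} := by
  have hc : Continuous fun w : Fin m → ℝ => w ⬝ᵥ w := by fun_prop
  have := lintegral_quad hM (φ := (Set.Iic 1).indicator 1) (measurable_one.indicator measurableSet_Iic)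
  rw [← lintegral_indicator_one (measurableSet_le (continuous_quad M).measurable measurable_const),
    ← lintegral_indicator_one (measurableSet_le hc.measurable measurable_const)]
  exact this

lemma volume_ball_ne_zero : volume {v : Fin m → ℝ | v ⬝ᵥ v ≤ 1} ≠ 0 := by
  have hc : Continuous fun w : Fin m → ℝ => w ⬝ᵥ w := by fun_prop
  have ho : IsOpen {v : Fin m → ℝ | v ⬝ᵥ v < 1} := isOpen_lt hc continuous_const
  refine fun h => (ho.measure_pos volume ⟨0, by simp⟩).ne' (measure_mono_null ?_ h)
  intro v hv
  exact (show v ⬝ᵥ v < 1 from hv).le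

lemma volume_ball_ne_top : volume {v : Fin m → ℝ | v ⬝ᵥ v ≤ 1} ≠ ⊤ := by
  refine ne_top_of_le_ne_top (measure_closedBall_lt_top (x := (0 : Fin m → ℝ)) (r := 1)).ne
    (measure_mono fun v hv => ?_)
  rw [mem_closedBall_zero_iff, pi_norm_le_iff_of_nonneg zero_le_one]
  intro i
  rw [Real.norm_eq_abs, ← sq_le_one_iff_abs_le_one]
  refine le_trans ?_ (show v ⬝ᵥ v ≤ 1 from hv)
  rw [dotProduct, pow_two]
  exact Finset.single_le_sum (f := fun i => v i * v i) (fun j _ => mul_self_nonneg _)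
    (Finset.mem_univ i)

lemma lintegral_gaussian_ne_zero :
    ∫⁻ v : Fin m → ℝ, ENNReal.ofReal (Real.exp (-(v ⬝ᵥ v) / 2)) ≠ 0 := by
  have hc : Continuous fun w : Fin m → ℝ => w ⬝ᵥ w := by fun_prop
  rw [← pos_iff_ne_zero, lintegral_pos_iff_support (by fun_prop)]
  have : (Function.support fun v : Fin m → ℝ => ENNReal.ofReal (Real.exp (-(v ⬝ᵥ v) / 2)))
      = Set.univ := by
    ext v
    simp [Real.exp_pos]
  rw [this]
  exact Measure.measure_univ_pos.mpr (NeZero.ne _)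

lemma lintegral_gaussian_ne_top :
    ∫⁻ v : Fin m → ℝ, ENNReal.ofReal (Real.exp (-(v ⬝ᵥ v) / 2)) ≠ ⊤ := by
  have h : Integrable fun v : Fin m → ℝ => ∏ i, Real.exp (-(1 / 2) * v i ^ 2) :=
    Integrable.fintype_prod (f := fun _ (x : ℝ) => Real.exp (-(1 / 2) * x ^ 2))
      fun _ => integrable_exp_neg_mul_sq (by norm_num)
  have h2 : (fun v : Fin m → ℝ => ∏ i, Real.exp (-(1 / 2) * v i ^ 2)) =
      fun v => Real.exp (-(v ⬝ᵥ v) / 2) := by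
    funext v
    rw [← Real.exp_sum]
    congr 1
    rw [dotProduct, ← Finset.sum_neg_distrib, Finset.sum_div]
    exact Finset.sum_congr rfl fun i _ => by ring
  rw [h2] at h
  exact h.lintegral_lt_top.ne

lemma lintegral_gaussian_quad {M : Matrix (Fin m) (Fin m) ℝ} (hM : M.PosDef) :
    ∫⁻ v : Fin m → ℝ, ENNReal.ofReal (Real.exp (-(v ⬝ᵥ (M *ᵥ v)) / 2)) =
      ENNReal.ofReal (√M.det)⁻¹ *
        ∫⁻ v : Fin m → ℝ, ENNReal.ofReal (Real.exp (-(v ⬝ᵥ v) / 2)) :=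
  lintegral_quad hM (φ := fun x => ENNReal.ofReal (Real.exp (-x / 2))) (by fun_prop)

/-- The determinant is monotone on positive definite matrices. -/
lemma det_le_det_of_le {M N : Matrix (Fin m) (Fin m) ℝ} (hM : M.PosDef) (hN : N.PosDef)
    (h : (N - M).PosSemidef) : M.det ≤ N.det := by
  have h1 : volume {v : Fin m → ℝ | v ⬝ᵥ (N *ᵥ v) ≤ 1} ≤
      volume {v : Fin m → ℝ | v ⬝ᵥ (M *ᵥ v) ≤ 1} :=
    measure_mono fun v hv => (quad_mono h v).trans hv
  rw [volume_quad_le hM, volume_quad_le hN,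
    ENNReal.mul_le_mul_iff_left volume_ball_ne_zero volume_ball_ne_top,
    ENNReal.ofReal_le_ofReal_iff (by positivity)] at h1
  have hM' := Real.sqrt_pos.mpr hM.det_pos
  have hN' := Real.sqrt_pos.mpr hN.det_pos
  rw [inv_le_inv₀ hN' hM'] at h1
  exact (Real.sqrt_le_sqrt_iff hN.det_pos.le).mp h1

end QuadraticForm

section Conditional

variable {Ω : Type*} {F m0 : MeasurableSpace Ω} {P : Measure Ω} [IsProbabilityMeasure P]

lemma lintegral_mul_le_of_condExp_le (hF : F ≤ m0) {h : Ω → ℝ}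
    (h0 : 0 ≤ h) (hmeas : Measurable h) (hint : Integrable h P) {c : ℝ}
    (hc : P[h | F] ≤ᵐ[P] fun _ => c) {g : Ω → ENNReal} (hg : Measurable[F] g) :
    ∫⁻ ω, g ω * ENNReal.ofReal (h ω) ∂P ≤ ENNReal.ofReal c * ∫⁻ ω, g ω ∂P := by
  have hle : (P.withDensity fun ω => ENNReal.ofReal (h ω)).trim hF ≤
      ENNReal.ofReal c • P.trim hF := by
    refine Measure.le_iff.mpr fun A hA => ?_
    rw [trim_measurableSet_eq hF hA, withDensity_apply _ (hF _ hA), Measure.smul_apply,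
      trim_measurableSet_eq hF hA, ← ofReal_integral_eq_lintegral_ofReal hint.integrableOn
        (Filter.Eventually.of_forall h0), ← setIntegral_condExp hF hint hA, smul_eq_mul]
    have h1 : ∫ ω in A, (P[h | F]) ω ∂P ≤ ∫ _ω in A, c ∂P :=
      setIntegral_mono_ae integrable_condExp.integrableOn (integrable_const c).integrableOn hc
    rw [setIntegral_const, smul_eq_mul, mul_comm] at h1
    refine (ENNReal.ofReal_le_ofReal h1).trans ?_
    rw [ENNReal.ofReal_mul' measureReal_nonneg, ofReal_measureReal]
  have hd : Measurable fun ω => ENNReal.ofReal (h ω) := hmeas.ennreal_ofReal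
  calc ∫⁻ ω, g ω * ENNReal.ofReal (h ω) ∂P
      = ∫⁻ ω, g ω ∂(P.withDensity fun ω => ENNReal.ofReal (h ω)) := by
        rw [lintegral_withDensity_eq_lintegral_mul _ hd (hg.mono hF le_rfl)]
        exact lintegral_congr fun ω => mul_comm _ _
    _ = ∫⁻ ω, g ω ∂((P.withDensity fun ω => ENNReal.ofReal (h ω)).trim hF) :=
        (lintegral_trim hF hg).symm
    _ ≤ ∫⁻ ω, g ω ∂(ENNReal.ofReal c • P.trim hF) := lintegral_mono' hle le_rfl
    _ = ENNReal.ofReal c * ∫⁻ ω, g ω ∂P := by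
        rw [lintegral_smul_measure, lintegral_trim hF hg, smul_eq_mul]

end Conditional
end RestrictedRegression

namespace RestrictedRegression

section Tail

variable {Ω : Type*} {m0 : MeasurableSpace Ω} {P : Measure Ω} [IsProbabilityMeasure P]

lemma exp_neg_le_one_sub_half {x : ℝ} (h0 : 0 ≤ x) (h1 : x ≤ 1) : Real.exp (-x) ≤ 1 - x / 2 := by
  have h := Real.add_one_le_exp x
  have hx : Real.exp (-x) * Real.exp x = 1 := by rw [← Real.exp_add]; simp
  have hp := Real.exp_pos (-x)
  nlinarith [mul_nonneg h0 (sub_nonneg.mpr h1)]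

/-- A multiplicative Chernoff bound for sums of `[0, 1]`-valued random variables with conditional
means at least `α`. -/
lemma measure_sum_le_of_condExp_ge (G : ℕ → MeasurableSpace Ω) (hG : ∀ j, G j ≤ m0)
    {b : ℕ → Ω → ℝ} (hb : ∀ i j, i < j → Measurable[G j] (b i))
    (h0 : ∀ j ω, 0 ≤ b j ω) (h1 : ∀ j ω, b j ω ≤ 1) {α : ℝ}
    (hα : ∀ j, ∀ᵐ ω ∂P, α ≤ (P[b j | G j]) ω) (T : ℕ) :
    P {ω | ∑ j ∈ Finset.range T, b j ω ≤ T * α / 8} ≤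
      ENNReal.ofReal (Real.exp (-(3 / 8 * (T * α)))) := by
  have hbm : ∀ j, Measurable (b j) := fun j => (hb j (j + 1) j.lt_succ_self).mono (hG _) le_rfl
  have hbi : ∀ j, Integrable (b j) P := fun j =>
    Integrable.of_bound (hbm j).aestronglyMeasurable 1
      (Filter.Eventually.of_forall fun ω => by
        rw [Real.norm_of_nonneg (h0 j ω)]; exact h1 j ω)
  have hei : ∀ j, Integrable (fun ω => Real.exp (-b j ω)) P := fun j =>
    Integrable.of_bound (hbm j).neg.exp.aestronglyMeasurable 1
      (Filter.Eventually.of_forall fun ω => by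
        rw [Real.norm_of_nonneg (Real.exp_pos _).le, Real.exp_le_one_iff]
        linarith [h0 j ω])
  have hcond : ∀ j, P[fun ω => Real.exp (-b j ω) | G j] ≤ᵐ[P] fun _ => Real.exp (-(α / 2)) := by
    intro j
    have h2 : P[fun ω => Real.exp (-b j ω) | G j] ≤ᵐ[P] P[(fun _ => (1 : ℝ)) - (1 / 2 : ℝ) • b j | G j] := by
      refine condExp_mono (hei j) ((integrable_const _).sub ((hbi j).smul _))
        (Filter.Eventually.of_forall fun ω => ?_)
      have := exp_neg_le_one_sub_half (h0 j ω) (h1 j ω)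
      simp only [Pi.sub_apply, Pi.smul_apply, smul_eq_mul]
      linarith
    have h3 := condExp_sub (integrable_const (1 : ℝ)) ((hbi j).smul (1 / 2 : ℝ)) (G j) (μ := P)
    have h4 := condExp_smul (1 / 2 : ℝ) (b j) (G j) (μ := P)
    rw [condExp_const (hG j)] at h3
    filter_upwards [h2, h3, h4, hα j] with ω e2 e3 e4 e5
    rw [e3, Pi.sub_apply, e4, Pi.smul_apply, smul_eq_mul] at e2
    have := Real.add_one_le_exp (-(α / 2))
    linarith
  have hmgf : ∀ T : ℕ, ∫⁻ ω, ENNReal.ofReal (Real.exp (-∑ j ∈ Finset.range T, b j ω)) ∂P ≤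
      ENNReal.ofReal (Real.exp (-(T * α / 2))) := by
    intro T
    induction T with
    | zero => simp
    | succ T ih =>
      have hg : Measurable[G T] fun ω =>
          ENNReal.ofReal (Real.exp (-∑ j ∈ Finset.range T, b j ω)) := by
        refine (Measurable.exp (Measurable.neg ?_)).ennreal_ofReal
        exact Finset.measurable_fun_sum _ fun j hj => hb j T (Finset.mem_range.mp hj)
      have := lintegral_mul_le_of_condExp_le (hG T) (fun ω => (Real.exp_pos _).le)
        (hbm T).neg.exp (hei T) (hcond T) hg
      calc _ = ∫⁻ ω, ENNReal.ofReal (Real.exp (-∑ j ∈ Finset.range T, b j ω)) *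
            ENNReal.ofReal (Real.exp (-b T ω)) ∂P := by
            refine lintegral_congr fun ω => ?_
            rw [← ENNReal.ofReal_mul (Real.exp_pos _).le, ← Real.exp_add, Finset.sum_range_succ]
            congr 2; ring
        _ ≤ _ := this
        _ ≤ ENNReal.ofReal (Real.exp (-(α / 2))) * ENNReal.ofReal (Real.exp (-(T * α / 2))) := by
            gcongr
        _ = _ := by
            rw [← ENNReal.ofReal_mul (Real.exp_pos _).le, ← Real.exp_add]
            congr 2; push_cast; ring
  have hmeas : Measurable fun ω => ENNReal.ofReal (Real.exp (-∑ j ∈ Finset.range T, b j ω)) :=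
    (Finset.measurable_fun_sum _ fun j _ => hbm j).neg.exp.ennreal_ofReal
  have hmarkov := (mul_meas_ge_le_lintegral (μ := P) hmeas
    (ENNReal.ofReal (Real.exp (-(T * α / 8))))).trans (hmgf T)
  have hsub : {ω | ∑ j ∈ Finset.range T, b j ω ≤ T * α / 8} ⊆
      {ω | ENNReal.ofReal (Real.exp (-(T * α / 8))) ≤
        ENNReal.ofReal (Real.exp (-∑ j ∈ Finset.range T, b j ω))} := by
    intro ω hω
    replace hω : ∑ j ∈ Finset.range T, b j ω ≤ T * α / 8 := hω
    exact ENNReal.ofReal_le_ofReal (Real.exp_le_exp.mpr (by linarith))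
  have e1 : ENNReal.ofReal (Real.exp (-(T * α / 2))) =
      ENNReal.ofReal (Real.exp (-(T * α / 8))) * ENNReal.ofReal (Real.exp (-(3 / 8 * (T * α)))) := by
    rw [← ENNReal.ofReal_mul (Real.exp_pos _).le, ← Real.exp_add]
    congr 2; ring
  rw [e1, ENNReal.mul_le_mul_iff_right (by simp [Real.exp_pos]) ENNReal.ofReal_ne_top] at hmarkov
  exact (measure_mono hsub).trans hmarkov

lemma sum_range_mul_eq (a : ℕ → ℝ) (k T : ℕ) :
    ∑ t ∈ Finset.range (T * k), a (t + 1) =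
      ∑ j ∈ Finset.range T, ∑ t ∈ Finset.Icc 1 k, a (j * k + t) := by
  induction T with
  | zero => simp
  | succ T ih =>
    rw [Nat.succ_mul, Finset.sum_range_add, ih, Finset.sum_range_succ]
    congr 1
    rw [Finset.range_eq_Ico]
    exact Finset.sum_Ico_add' (fun t => a (T * k + t)) 0 k 1

/-- A lower tail bound for sums of `[0, 1]`-valued random variables whose conditional means, averaged
over a block of length `k`, are at least `α`. -/
lemma measure_sum_le_of_block_condExp_ge (F : ℕ → MeasurableSpace Ω) (hF : ∀ t, F t ≤ m0)
    (hmono : Monotone F) {a : ℕ → Ω → ℝ} (ha : ∀ t, 1 ≤ t → Measurable[F t] (a t))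
    (h0 : ∀ t ω, 0 ≤ a t ω) (h1 : ∀ t ω, a t ω ≤ 1) {k : ℕ} (hk : 1 ≤ k) {α : ℝ}
    (hα : ∀ s, ∀ᵐ ω ∂P,
      α ≤ (P[fun ω => (k : ℝ)⁻¹ * ∑ t ∈ Finset.Icc 1 k, a (s + t) ω | F s]) ω) (n : ℕ) :
    P {ω | ∑ t ∈ Finset.range n, a (t + 1) ω ≤ ((n / k * k : ℕ) : ℝ) * α / 8} ≤
      ENNReal.ofReal (Real.exp (-(3 / 8 * ((n / k : ℕ) * α)))) := by
  have hk0 : (0 : ℝ) < k := by exact_mod_cast hk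
  refine (measure_mono ?_).trans (measure_sum_le_of_condExp_ge (P := P) (fun j => F (j * k))
    (fun j => hF _) (b := fun j ω => (k : ℝ)⁻¹ * ∑ t ∈ Finset.Icc 1 k, a (j * k + t) ω)
    ?_ ?_ ?_ (fun j => hα (j * k)) (n / k))
  · intro ω hω
    replace hω : ∑ t ∈ Finset.range n, a (t + 1) ω ≤ ((n / k * k : ℕ) : ℝ) * α / 8 := hω
    show ∑ j ∈ Finset.range (n / k), (k : ℝ)⁻¹ * ∑ t ∈ Finset.Icc 1 k, a (j * k + t) ω ≤ _
    rw [← Finset.mul_sum, ← sum_range_mul_eq (fun t => a t ω), inv_mul_le_iff₀ hk0]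
    have h2 : ∑ t ∈ Finset.range (n / k * k), a (t + 1) ω ≤ ∑ t ∈ Finset.range n, a (t + 1) ω :=
      Finset.sum_le_sum_of_subset_of_nonneg
        (Finset.range_subset_range.mpr (Nat.div_mul_le_self n k)) fun t _ _ => h0 _ _
    push_cast at hω
    linarith
  · intro i j hij
    refine Measurable.const_mul (Finset.measurable_fun_sum _ fun t ht => ?_) _
    rw [Finset.mem_Icc] at ht
    refine (ha (i * k + t) (by omega)).mono (hmono ?_) le_rfl
    calc i * k + t ≤ (i + 1) * k := by rw [add_mul]; omega
      _ ≤ j * k := Nat.mul_le_mul_right k hij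
  · intro j ω
    exact mul_nonneg (by positivity) (Finset.sum_nonneg fun t _ => h0 _ _)
  · intro j ω
    show _ ≤ _
    rw [inv_mul_le_iff₀ hk0]
    refine (Finset.sum_le_card_nsmul _ _ 1 fun t _ => h1 _ _).trans ?_
    simp

end Tail

section Noise

variable {Ω : Type*} {q : ℕ}

lemma lintegral_mul_exp_const_le {F m0 : MeasurableSpace Ω} {P : Measure Ω}
    [IsProbabilityMeasure P] (hF : F ≤ m0)
    {ξ : Ω → Fin q → ℝ} (hξ : Measurable ξ) {σ : ℝ} (hsub : CondSubGaussian P F ξ σ)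
    (c : Fin q → ℝ) {g : Ω → ENNReal} (hg : Measurable[F] g) :
    ∫⁻ ω, g ω * ENNReal.ofReal (Real.exp (c ⬝ᵥ ξ ω - σ ^ 2 / 2 * (c ⬝ᵥ c))) ∂P ≤
      ∫⁻ ω, g ω ∂P := by
  by_cases hc : c = 0
  · simp [hc]
  have hcc : 0 < c ⬝ᵥ c := by
    have := quad_pos (Matrix.PosDef.one (n := Fin q) (R := ℝ)) hc
    rwa [Matrix.one_mulVec] at this
  set l := √(c ⬝ᵥ c) with hl
  have hl0 : 0 < l := Real.sqrt_pos.mpr hcc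
  have hl2 : l ^ 2 = c ⬝ᵥ c := Real.sq_sqrt hcc.le
  obtain ⟨-, -, h3⟩ := hsub
  have hu : (l⁻¹ • c) ⬝ᵥ (l⁻¹ • c) = 1 := by
    rw [dotProduct_smul, smul_dotProduct, smul_eq_mul, smul_eq_mul, ← hl2]
    field_simp
  obtain ⟨hint, hle⟩ := h3 (l⁻¹ • c) hu l
  have heq : (fun ω => Real.exp (l * ((l⁻¹ • c) ⬝ᵥ ξ ω))) = fun ω => Real.exp (c ⬝ᵥ ξ ω) := by
    funext ω
    rw [smul_dotProduct, smul_eq_mul, mul_inv_cancel_left₀ hl0.ne']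
  rw [heq] at hint hle
  have hm : Measurable fun ω => Real.exp (c ⬝ᵥ ξ ω) := by
    refine Measurable.exp ?_
    exact (show Continuous fun x : Fin q → ℝ => c ⬝ᵥ x by fun_prop).measurable.comp hξ
  have := lintegral_mul_le_of_condExp_le hF (fun ω => (Real.exp_pos _).le) hm hint hle hg
  set e := Real.exp (σ ^ 2 * l ^ 2 / 2) with he
  have he0 : 0 < e := Real.exp_pos _
  calc ∫⁻ ω, g ω * ENNReal.ofReal (Real.exp (c ⬝ᵥ ξ ω - σ ^ 2 / 2 * (c ⬝ᵥ c))) ∂P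
      = ∫⁻ ω, ENNReal.ofReal e⁻¹ * (g ω * ENNReal.ofReal (Real.exp (c ⬝ᵥ ξ ω))) ∂P := by
        refine lintegral_congr fun ω => ?_
        rw [mul_left_comm, ← ENNReal.ofReal_mul (by positivity), he, ← Real.exp_neg,
          ← Real.exp_add, hl2]
        congr 3; ring
    _ = ENNReal.ofReal e⁻¹ * ∫⁻ ω, g ω * ENNReal.ofReal (Real.exp (c ⬝ᵥ ξ ω)) ∂P :=
        lintegral_const_mul _ ((hg.mono hF le_rfl).mul hm.ennreal_ofReal)
    _ ≤ ENNReal.ofReal e⁻¹ * (ENNReal.ofReal e * ∫⁻ ω, g ω ∂P) := by gcongr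
    _ = ∫⁻ ω, g ω ∂P := by
        rw [← mul_assoc, ← ENNReal.ofReal_mul (by positivity), inv_mul_cancel₀ he0.ne']
        simp

/-- The sub-Gaussian bound with a random direction `v` known at the time of conditioning. -/
lemma lintegral_mul_exp_le {F m0 : MeasurableSpace Ω} {P : Measure Ω}
    [IsProbabilityMeasure P] (hF : F ≤ m0)
    {ξ : Ω → Fin q → ℝ} (hξ : Measurable ξ) {σ : ℝ} (hsub : CondSubGaussian P F ξ σ)
    {v : Ω → Fin q → ℝ} (hv : Measurable[F] v) {g : Ω → ENNReal} (hg : Measurable[F] g) :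
    ∫⁻ ω, g ω * ENNReal.ofReal (Real.exp (v ω ⬝ᵥ ξ ω - σ ^ 2 / 2 * (v ω ⬝ᵥ v ω))) ∂P ≤
      ∫⁻ ω, g ω ∂P := by
  have hcont : Continuous fun x : (Fin q → ℝ) × (Fin q → ℝ) =>
      Real.exp (x.1 ⬝ᵥ x.2 - σ ^ 2 / 2 * (x.1 ⬝ᵥ x.1)) := by fun_prop
  have hmeas : ∀ w : Ω → Fin q → ℝ, Measurable[F] w → Measurable[m0] fun ω =>
      g ω * ENNReal.ofReal (Real.exp (w ω ⬝ᵥ ξ ω - σ ^ 2 / 2 * (w ω ⬝ᵥ w ω))) := by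
    intro w hw
    refine (hg.mono hF le_rfl).mul (Measurable.ennreal_ofReal ?_)
    exact hcont.measurable.comp ((hw.mono hF le_rfl).prodMk hξ)
  have simple : ∀ (w : Ω → Fin q → ℝ) (V : Finset (Fin q → ℝ)), Measurable[F] w →
      (∀ ω, w ω ∈ V) →
      ∫⁻ ω, g ω * ENNReal.ofReal (Real.exp (w ω ⬝ᵥ ξ ω - σ ^ 2 / 2 * (w ω ⬝ᵥ w ω))) ∂P ≤
        ∫⁻ ω, g ω ∂P := by
    intro w V hw hV
    have hset : ∀ c, MeasurableSet[F] (w ⁻¹' {c}) := fun c => hw (measurableSet_singleton c)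
    have hgi : ∀ c, Measurable[F] ((w ⁻¹' {c}).indicator g) := fun c => hg.indicator (hset c)
    have split : ∀ (ω : Ω) (φ : (Fin q → ℝ) → ENNReal), g ω * φ (w ω) =
        ∑ c ∈ V, (w ⁻¹' {c}).indicator g ω * φ c := by
      intro ω φ
      rw [Finset.sum_eq_single (w ω)]
      · simp [Set.indicator]
      · intro c _ hc
        simp [Set.indicator, hc.symm]
      · intro h
        exact absurd (hV ω) h
    have e1 : ∀ ω, g ω * ENNReal.ofReal (Real.exp (w ω ⬝ᵥ ξ ω - σ ^ 2 / 2 * (w ω ⬝ᵥ w ω))) =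
        ∑ c ∈ V, (w ⁻¹' {c}).indicator g ω *
          ENNReal.ofReal (Real.exp (c ⬝ᵥ ξ ω - σ ^ 2 / 2 * (c ⬝ᵥ c))) := fun ω =>
      split ω fun c => ENNReal.ofReal (Real.exp (c ⬝ᵥ ξ ω - σ ^ 2 / 2 * (c ⬝ᵥ c)))
    have e2 : ∀ ω, g ω = ∑ c ∈ V, (w ⁻¹' {c}).indicator g ω := fun ω => by
      simpa using split ω fun _ => 1
    calc _ = ∑ c ∈ V, ∫⁻ ω, (w ⁻¹' {c}).indicator g ω *
          ENNReal.ofReal (Real.exp (c ⬝ᵥ ξ ω - σ ^ 2 / 2 * (c ⬝ᵥ c))) ∂P := by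
          simp_rw [e1]
          refine lintegral_finsetSum _ fun c _ => ?_
          refine ((hgi c).mono hF le_rfl).mul (Measurable.ennreal_ofReal ?_)
          exact hcont.measurable.comp (measurable_const.prodMk hξ)
      _ ≤ ∑ c ∈ V, ∫⁻ ω, (w ⁻¹' {c}).indicator g ω ∂P :=
          Finset.sum_le_sum fun c _ => lintegral_mul_exp_const_le hF hξ hsub c (hgi c)
      _ = ∫⁻ ω, g ω ∂P := by
          rw [← lintegral_finsetSum _ fun c _ => (hgi c).mono hF le_rfl]
          exact lintegral_congr fun ω => (e2 ω).symm
  have hsm : StronglyMeasurable[F] v := hv.stronglyMeasurable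
  have hlim : ∀ ω, Filter.Tendsto (fun i => g ω * ENNReal.ofReal (Real.exp
      (hsm.approx i ω ⬝ᵥ ξ ω - σ ^ 2 / 2 * (hsm.approx i ω ⬝ᵥ hsm.approx i ω)))) Filter.atTop
      (nhds (g ω * ENNReal.ofReal (Real.exp (v ω ⬝ᵥ ξ ω - σ ^ 2 / 2 * (v ω ⬝ᵥ v ω))))) := by
    intro ω
    have h1 := (hcont.tendsto (v ω, ξ ω)).comp
      ((hsm.tendsto_approx ω).prodMk_nhds (tendsto_const_nhds (x := ξ ω)))
    refine ENNReal.Tendsto.const_mul (ENNReal.tendsto_ofReal h1) (Or.inl ?_)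
    simp [Real.exp_pos]
  calc _ = ∫⁻ ω, Filter.liminf (fun i => g ω * ENNReal.ofReal (Real.exp
      (hsm.approx i ω ⬝ᵥ ξ ω - σ ^ 2 / 2 * (hsm.approx i ω ⬝ᵥ hsm.approx i ω)))) Filter.atTop ∂P :=
        lintegral_congr fun ω => (hlim ω).liminf_eq.symm
    _ ≤ Filter.liminf (fun i => ∫⁻ ω, g ω * ENNReal.ofReal (Real.exp
      (hsm.approx i ω ⬝ᵥ ξ ω - σ ^ 2 / 2 * (hsm.approx i ω ⬝ᵥ hsm.approx i ω))) ∂P)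
        Filter.atTop :=
        lintegral_liminf_le fun i => hmeas _ (@SimpleFunc.measurable _ _ F _ (hsm.approx i))
    _ ≤ ∫⁻ ω, g ω ∂P := by
        refine Filter.liminf_le_of_le (by isBoundedDefault) fun b hb => ?_
        obtain ⟨i, hi⟩ := hb.exists
        exact hi.trans (simple _ (@SimpleFunc.range _ _ F (hsm.approx i))
          (@SimpleFunc.measurable _ _ F _ (hsm.approx i))
          (@SimpleFunc.mem_range_self _ _ F (hsm.approx i)))

/-- The exponential supermartingale of a sub-Gaussian martingale transform. -/
lemma lintegral_exp_sum_le_one [m0 : MeasurableSpace Ω] {P : Measure Ω} [IsProbabilityMeasure P]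
    (F : ℕ → MeasurableSpace Ω) (hF : ∀ t, F t ≤ m0) (hmono : Monotone F)
    {η : ℕ → Ω → Fin q → ℝ} (hη : ∀ t, 1 ≤ t → Measurable[F (t + 1)] (η t)) {σ : ℝ}
    (hsub : ∀ t, 1 ≤ t → CondSubGaussian P (F t) (η t) σ)
    {v : ℕ → Ω → Fin q → ℝ} (hv : ∀ t, 1 ≤ t → Measurable[F t] (v t)) (n : ℕ) :
    ∫⁻ ω, ENNReal.ofReal (Real.exp (∑ t ∈ Finset.range n, (v (t + 1) ω ⬝ᵥ η (t + 1) ω -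
      σ ^ 2 / 2 * (v (t + 1) ω ⬝ᵥ v (t + 1) ω)))) ∂P ≤ 1 := by
  induction n with
  | zero => simp
  | succ n ih =>
    have hcont : Continuous fun x : (Fin q → ℝ) × (Fin q → ℝ) =>
      x.1 ⬝ᵥ x.2 - σ ^ 2 / 2 * (x.1 ⬝ᵥ x.1) := by fun_prop
    have hg : Measurable[F (n + 1)] fun ω => ENNReal.ofReal (Real.exp (∑ t ∈ Finset.range n,
        (v (t + 1) ω ⬝ᵥ η (t + 1) ω - σ ^ 2 / 2 * (v (t + 1) ω ⬝ᵥ v (t + 1) ω)))) := by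
      refine Measurable.ennreal_ofReal (Measurable.exp (Finset.measurable_fun_sum _ fun t ht => ?_))
      rw [Finset.mem_range] at ht
      exact hcont.measurable.comp
        (((hv (t + 1) (by omega)).mono (hmono (by omega)) le_rfl).prodMk
          ((hη (t + 1) (by omega)).mono (hmono (by omega)) le_rfl))
    refine le_trans (le_of_eq ?_) ((lintegral_mul_exp_le (hF (n + 1))
      ((hη (n + 1) (by omega)).mono (hF _) le_rfl) (hsub (n + 1) (by omega))
      (hv (n + 1) (by omega)) hg).trans ih)
    refine lintegral_congr fun ω => ?_
    rw [← ENNReal.ofReal_mul (Real.exp_pos _).le, ← Real.exp_add, Finset.sum_range_succ]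

end Noise
end RestrictedRegression

namespace RestrictedRegression

section RandomQuadratic

variable {Ω : Type*} [MeasurableSpace Ω] {P : Measure Ω} [SFinite P] {m : ℕ}

lemma measurable_quad {G : Ω → Matrix (Fin m) (Fin m) ℝ}
    (hG : ∀ i j, Measurable fun ω => G ω i j) :
    Measurable fun x : Ω × (Fin m → ℝ) => x.2 ⬝ᵥ (G x.1 *ᵥ x.2) := by
  simp only [dotProduct, Matrix.mulVec]
  have h2 : ∀ i, Measurable fun x : Ω × (Fin m → ℝ) => x.2 i := fun i =>
    (measurable_pi_apply i).comp measurable_snd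
  exact Finset.measurable_fun_sum _ fun i _ => (h2 i).mul
    (Finset.measurable_fun_sum _ fun j _ => ((hG i j).comp measurable_fst).mul (h2 j))

/-- If `w` has small `G`-norm relative to its `M`-norm and `G ≤ N`, then so does every point of an
`N`-ellipsoid around a multiple of `w`. -/
lemma exists_ellipsoid_of_quad_lt {G M N : Matrix (Fin m) (Fin m) ℝ} (hG : G.PosSemidef)
    (hM : M.PosDef) (hMN : (N - M).PosSemidef) (hGN : (N - G).PosSemidef) {w : Fin m → ℝ}
    (hw : w ⬝ᵥ (G *ᵥ w) < 9 / 16 * (w ⬝ᵥ (M *ᵥ w))) :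
    ∃ z : Fin m → ℝ, ∀ v : Fin m → ℝ, (v - z) ⬝ᵥ (N *ᵥ (v - z)) ≤ (1 / 8) ^ 2 →
      v ⬝ᵥ (M *ᵥ v) ≤ (9 / 8) ^ 2 ∧ v ⬝ᵥ (G *ᵥ v) < v ⬝ᵥ (M *ᵥ v) := by
  have hMw : 0 < w ⬝ᵥ (M *ᵥ w) := by linarith [quad_nonneg hG w]
  set c := (√(w ⬝ᵥ (M *ᵥ w)))⁻¹ with hc
  have hc2 : c ^ 2 = (w ⬝ᵥ (M *ᵥ w))⁻¹ := by rw [hc, inv_pow, Real.sq_sqrt hMw.le]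
  refine ⟨c • w, fun v hv => ?_⟩
  set z := c • w with hz
  have hMz : z ⬝ᵥ (M *ᵥ z) = 1 := by rw [hz, quad_smul_vec, hc2, inv_mul_cancel₀ hMw.ne']
  have hGz : z ⬝ᵥ (G *ᵥ z) < (3 / 4) ^ 2 := by
    rw [hz, quad_smul_vec, hc2, inv_mul_lt_iff₀ hMw]
    linarith
  have sG : √(z ⬝ᵥ (G *ᵥ z)) < 3 / 4 := (Real.sqrt_lt' (by norm_num)).mpr hGz
  have sM : √(z ⬝ᵥ (M *ᵥ z)) = 1 := by rw [hMz, Real.sqrt_one]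
  have dM : √((v - z) ⬝ᵥ (M *ᵥ (v - z))) ≤ 1 / 8 :=
    Real.sqrt_le_iff.mpr ⟨by norm_num, (quad_mono hMN _).trans hv⟩
  have dG : √((v - z) ⬝ᵥ (G *ᵥ (v - z))) ≤ 1 / 8 :=
    Real.sqrt_le_iff.mpr ⟨by norm_num, (quad_mono hGN _).trans hv⟩
  have tM := sqrt_quad_add_le hM.posSemidef (v - z) z
  have tG := sqrt_quad_add_le hG (v - z) z
  have rM := sqrt_quad_add_le hM.posSemidef (z - v) v
  have hneg : (z - v) ⬝ᵥ (M *ᵥ (z - v)) = (v - z) ⬝ᵥ (M *ᵥ (v - z)) := by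
    rw [← neg_sub v z, Matrix.mulVec_neg, neg_dotProduct_neg]
  rw [sub_add_cancel] at tM tG rM
  rw [hneg] at rM
  constructor
  · exact (Real.sqrt_le_left (by norm_num)).mp (by linarith)
  · exact (Real.sqrt_lt_sqrt_iff (quad_nonneg hG v)).mp (by linarith)

/-- A uniform lower bound for a random quadratic form from a pointwise one: the expected volume of the
set of exceptional vectors controls the probability that there is one. -/
lemma measure_exists_quad_lt_le {G : Ω → Matrix (Fin m) (Fin m) ℝ}
    (hGm : ∀ i j, Measurable fun ω => G ω i j) (hG : ∀ ω, (G ω).PosSemidef)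
    {M N : Matrix (Fin m) (Fin m) ℝ} (hM : M.PosDef) (hN : N.PosDef)
    (hMN : (N - M).PosSemidef) {p : ENNReal}
    (hp : ∀ v : Fin m → ℝ, P {ω | v ⬝ᵥ (G ω *ᵥ v) < v ⬝ᵥ (M *ᵥ v)} ≤ p) :
    P {ω | (N - G ω).PosSemidef ∧ ∃ w : Fin m → ℝ,
        w ⬝ᵥ (G ω *ᵥ w) < 9 / 16 * (w ⬝ᵥ (M *ᵥ w))} ≤
      p * ENNReal.ofReal (9 ^ m * √(N.det / M.det)) := by
  set E₁ : Set (Fin m → ℝ) := {v | v ⬝ᵥ (((8 / 9 : ℝ) ^ 2 • M) *ᵥ v) ≤ 1} with hE₁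
  set E₂ : Set (Fin m → ℝ) := {v | v ⬝ᵥ (((8 : ℝ) ^ 2 • N) *ᵥ v) ≤ 1} with hE₂
  have hE₁m : MeasurableSet E₁ := measurableSet_le (continuous_quad _).measurable measurable_const
  set D : Set (Ω × (Fin m → ℝ)) :=
    {x | x.2 ∈ E₁ ∧ x.2 ⬝ᵥ (G x.1 *ᵥ x.2) < x.2 ⬝ᵥ (M *ᵥ x.2)} with hD
  have hDm : MeasurableSet D := (measurable_snd hE₁m).inter
    (measurableSet_lt (measurable_quad hGm) ((continuous_quad M).measurable.comp measurable_snd))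
  have hexp : ∫⁻ ω, volume (Prod.mk ω ⁻¹' D) ∂P ≤ p * volume E₁ := by
    rw [← Measure.prod_apply hDm, Measure.prod_apply_symm hDm, ← lintegral_indicator_const hE₁m]
    refine lintegral_mono fun v => ?_
    by_cases hv : v ∈ E₁
    · rw [Set.indicator_of_mem hv]
      exact (measure_mono fun ω hω => hω.2).trans (hp v)
    · rw [Set.indicator_of_notMem hv, nonpos_iff_eq_zero]
      exact measure_mono_null (t := ∅) (fun ω hω => hv hω.1) measure_empty
  have hsub : {ω | (N - G ω).PosSemidef ∧ ∃ w : Fin m → ℝ,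
        w ⬝ᵥ (G ω *ᵥ w) < 9 / 16 * (w ⬝ᵥ (M *ᵥ w))} ⊆
      {ω | volume E₂ ≤ volume (Prod.mk ω ⁻¹' D)} := by
    rintro ω ⟨h1, w, hw⟩
    obtain ⟨z, hz⟩ := exists_ellipsoid_of_quad_lt (hG ω) hM hMN h1 hw
    show volume E₂ ≤ volume (Prod.mk ω ⁻¹' D)
    rw [← measure_preimage_add_right volume (-z) E₂]
    refine measure_mono fun v hv => ?_
    replace hv : (v - z) ⬝ᵥ (((8 : ℝ) ^ 2 • N) *ᵥ (v - z)) ≤ 1 := by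
      rw [sub_eq_add_neg]; exact hv
    rw [quad_smul] at hv
    obtain ⟨h2, h3⟩ := hz v (by linarith)
    refine ⟨?_, h3⟩
    show v ⬝ᵥ (((8 / 9 : ℝ) ^ 2 • M) *ᵥ v) ≤ 1
    rw [quad_smul]
    linarith
  have hmarkov := (mul_meas_ge_le_lintegral (μ := P)
    (measurable_measure_prodMk_left (ν := volume) hDm) (volume E₂)).trans hexp
  have hM' : ((8 / 9 : ℝ) ^ 2 • M).PosDef := hM.smul (by norm_num)
  have hN' : ((8 : ℝ) ^ 2 • N).PosDef := hN.smul (by norm_num)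
  have hMd := hM.det_pos
  have hNd := hN.det_pos
  have sM : √((8 / 9 : ℝ) ^ 2 • M).det = (8 / 9) ^ m * √M.det := by
    rw [Matrix.det_smul, Fintype.card_fin, Real.sqrt_mul (by positivity), ← pow_mul, mul_comm 2,
      pow_mul, Real.sqrt_sq (by positivity)]
  have sN : √((8 : ℝ) ^ 2 • N).det = 8 ^ m * √N.det := by
    rw [Matrix.det_smul, Fintype.card_fin, Real.sqrt_mul (by positivity), ← pow_mul, mul_comm 2,
      pow_mul, Real.sqrt_sq (by positivity)]
  have hvol : volume E₁ = ENNReal.ofReal (9 ^ m * √(N.det / M.det)) * volume E₂ := by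
    rw [hE₁, hE₂, volume_quad_le hM', volume_quad_le hN', ← mul_assoc,
      ← ENNReal.ofReal_mul (by positivity), sM, sN, Real.sqrt_div hNd.le, div_pow]
    have := Real.sqrt_pos.mpr hMd
    have := Real.sqrt_pos.mpr hNd
    congr 2
    field_simp
  have hne : volume E₂ ≠ 0 := by
    rw [hE₂, volume_quad_le hN']
    refine mul_ne_zero ?_ volume_ball_ne_zero
    simp only [ne_eq, ENNReal.ofReal_eq_zero, not_le, inv_pos]
    exact Real.sqrt_pos.mpr hN'.det_pos
  have hnt : volume E₂ ≠ ⊤ := by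
    rw [hE₂, volume_quad_le hN']
    exact ENNReal.mul_ne_top ENNReal.ofReal_ne_top volume_ball_ne_top
  rw [hvol, ← mul_assoc, mul_comm, ENNReal.mul_le_mul_iff_left hne hnt] at hmarkov
  exact (measure_mono hsub).trans hmarkov

/-- A self-normalized tail bound, by the method of mixtures with a Gaussian mixing distribution. -/
lemma measure_exists_mixture_lt_le {G : Ω → Matrix (Fin m) (Fin m) ℝ} {S : Ω → Fin m → ℝ}
    (hGm : ∀ i j, Measurable fun ω => G ω i j) (hSm : Measurable S)
    (hG : ∀ ω, (G ω).PosSemidef)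
    (hexp : ∀ w : Fin m → ℝ, ∫⁻ ω, ENNReal.ofReal
      (Real.exp (w ⬝ᵥ S ω - 1 / 2 * (w ⬝ᵥ (G ω *ᵥ w)))) ∂P ≤ 1)
    {V N : Matrix (Fin m) (Fin m) ℝ} (hV : V.PosDef) (hN : N.PosDef) {δ : ℝ} (hδ : 0 < δ) :
    P {ω | (N - (G ω + V)).PosSemidef ∧ ∃ w : Fin m → ℝ,
        Real.log (1 / δ) + 1 / 2 * Real.log (N.det / V.det) <
          w ⬝ᵥ S ω - 1 / 2 * (w ⬝ᵥ ((G ω + V) *ᵥ w))} ≤ ENNReal.ofReal δ := by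
  set J := ∫⁻ v : Fin m → ℝ, ENNReal.ofReal (Real.exp (-(v ⬝ᵥ v) / 2)) with hJ
  have hJ0 : J ≠ 0 := lintegral_gaussian_ne_zero
  have hJt : J ≠ ⊤ := lintegral_gaussian_ne_top
  have hVd := Real.sqrt_pos.mpr hV.det_pos
  have hNd := Real.sqrt_pos.mpr hN.det_pos
  set f : Ω → (Fin m → ℝ) → ENNReal := fun ω w => ENNReal.ofReal
    (Real.exp (w ⬝ᵥ S ω - 1 / 2 * (w ⬝ᵥ (G ω *ᵥ w)))) *
      ENNReal.ofReal (Real.exp (-(w ⬝ᵥ (V *ᵥ w)) / 2)) with hf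
  have hfm : Measurable (Function.uncurry f) := by
    refine Measurable.mul (Measurable.ennreal_ofReal (Measurable.exp (Measurable.sub ?_ ?_))) ?_
    · exact (show Continuous fun x : (Fin m → ℝ) × (Fin m → ℝ) => x.1 ⬝ᵥ x.2 by
        fun_prop).measurable.comp (measurable_snd.prodMk (hSm.comp measurable_fst))
    · exact (measurable_quad hGm).const_mul _
    · refine Measurable.ennreal_ofReal (Measurable.exp (Measurable.div_const (Measurable.neg ?_) _))
      exact (continuous_quad V).measurable.comp measurable_snd
  have hmean : ∫⁻ ω, (∫⁻ w, f ω w) ∂P ≤ ENNReal.ofReal (√V.det)⁻¹ * J := by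
    rw [lintegral_lintegral_swap hfm.aemeasurable, ← lintegral_gaussian_quad hV]
    refine lintegral_mono fun w => ?_
    rw [lintegral_mul_const']
    · exact mul_le_of_le_one_left zero_le (hexp w)
    · exact ENNReal.ofReal_ne_top
  have hsub : {ω | (N - (G ω + V)).PosSemidef ∧ ∃ w : Fin m → ℝ,
        Real.log (1 / δ) + 1 / 2 * Real.log (N.det / V.det) <
          w ⬝ᵥ S ω - 1 / 2 * (w ⬝ᵥ ((G ω + V) *ᵥ w))} ⊆
      {ω | ENNReal.ofReal δ⁻¹ * (ENNReal.ofReal (√V.det)⁻¹ * J) ≤ ∫⁻ w, f ω w} := by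
    rintro ω ⟨hle, w₁, hw₁⟩
    set M := G ω + V with hMdef
    have hM : M.PosDef := Matrix.PosDef.posSemidef_add (hG ω) hV
    have hMT : Mᵀ = M := by simpa using hM.isHermitian.eq
    set w₀ := M⁻¹ *ᵥ S ω with hw₀
    have hS : S ω = M *ᵥ w₀ := by
      rw [hw₀, Matrix.mulVec_mulVec, Matrix.mul_nonsing_inv _ hM.det_pos.ne'.isUnit,
        Matrix.one_mulVec]
    have square : ∀ w, w ⬝ᵥ S ω - 1 / 2 * (w ⬝ᵥ (M *ᵥ w)) =
        1 / 2 * (w₀ ⬝ᵥ (M *ᵥ w₀)) - 1 / 2 * ((w - w₀) ⬝ᵥ (M *ᵥ (w - w₀))) := by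
      intro w
      have hsymm : w₀ ⬝ᵥ (M *ᵥ w) = w ⬝ᵥ (M *ᵥ w₀) := by
        rw [Matrix.dotProduct_mulVec, ← Matrix.mulVec_transpose, hMT, dotProduct_comm]
      rw [hS, Matrix.mulVec_sub, dotProduct_sub, sub_dotProduct, sub_dotProduct, hsymm]
      ring
    set K := 1 / 2 * (w₀ ⬝ᵥ (M *ᵥ w₀)) with hK
    have hKlt : Real.log (1 / δ) + 1 / 2 * Real.log (N.det / V.det) < K := by
      have := quad_nonneg hM.posSemidef (w₁ - w₀)
      rw [square] at hw₁
      linarith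
    have hexpK : δ⁻¹ * (√V.det)⁻¹ ≤ Real.exp K * (√N.det)⁻¹ := by
      have h1 : Real.exp (Real.log (1 / δ) + 1 / 2 * Real.log (N.det / V.det)) =
          δ⁻¹ * (√N.det / √V.det) := by
        rw [Real.exp_add, Real.exp_log (by positivity), ← Real.sqrt_div hN.det_pos.le, one_div,
          Real.sqrt_eq_rpow, Real.rpow_def_of_pos (div_pos hN.det_pos hV.det_pos), mul_comm (1 / 2)]
      have h2 := Real.exp_le_exp.mpr hKlt.le
      rw [h1] at h2
      calc δ⁻¹ * (√V.det)⁻¹ = δ⁻¹ * (√N.det / √V.det) * (√N.det)⁻¹ := by field_simp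
        _ ≤ _ := by gcongr
    have hint : ∫⁻ w, f ω w = ENNReal.ofReal (Real.exp K) *
        ∫⁻ u : Fin m → ℝ, ENNReal.ofReal (Real.exp (-(u ⬝ᵥ (M *ᵥ u)) / 2)) := by
      rw [← lintegral_sub_right_eq_self (fun u => ENNReal.ofReal (Real.exp (-(u ⬝ᵥ (M *ᵥ u)) / 2))) w₀,
        ← lintegral_const_mul' _ _ ENNReal.ofReal_ne_top]
      refine lintegral_congr fun w => ?_
      rw [hf]
      dsimp only
      rw [← ENNReal.ofReal_mul (Real.exp_pos _).le, ← ENNReal.ofReal_mul (Real.exp_pos _).le,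
        ← Real.exp_add, ← Real.exp_add]
      have := square w
      rw [hMdef, Matrix.add_mulVec, dotProduct_add, ← hMdef] at this
      congr 2
      linarith
    show _ ≤ ∫⁻ w, f ω w
    rw [hint, ← mul_assoc, ← ENNReal.ofReal_mul (by positivity)]
    calc _ ≤ ENNReal.ofReal (Real.exp K * (√N.det)⁻¹) * J := by gcongr
      _ = ENNReal.ofReal (Real.exp K) *
          ∫⁻ u : Fin m → ℝ, ENNReal.ofReal (Real.exp (-(u ⬝ᵥ (N *ᵥ u)) / 2)) := by
          rw [lintegral_gaussian_quad hN, ← mul_assoc, ENNReal.ofReal_mul (Real.exp_pos _).le]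
      _ ≤ _ := by
          gcongr with u
          exact quad_mono hle u
  have hmarkov := (mul_meas_ge_le_lintegral (μ := P) hfm.lintegral_prod_right
    (ENNReal.ofReal δ⁻¹ * (ENNReal.ofReal (√V.det)⁻¹ * J))).trans hmean
  set c := ENNReal.ofReal (√V.det)⁻¹ * J with hc
  have hc0 : c ≠ 0 := mul_ne_zero (by simpa using hVd) hJ0
  have hct : c ≠ ⊤ := ENNReal.mul_ne_top ENNReal.ofReal_ne_top hJt
  refine (measure_mono hsub).trans ?_
  have h3 : ENNReal.ofReal δ * ENNReal.ofReal δ⁻¹ = 1 := by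
    rw [← ENNReal.ofReal_mul hδ.le, mul_inv_cancel₀ hδ.ne', ENNReal.ofReal_one]
  rw [← ENNReal.mul_le_mul_iff_left hc0 hct]
  calc _ = ENNReal.ofReal δ * (ENNReal.ofReal δ⁻¹ * c *
        P {ω | ENNReal.ofReal δ⁻¹ * c ≤ ∫⁻ w, f ω w}) := by
        rw [mul_assoc (ENNReal.ofReal δ⁻¹), ← mul_assoc (ENNReal.ofReal δ), h3, one_mul, mul_comm c]
    _ ≤ _ := by gcongr

end RandomQuadratic
end RestrictedRegression

namespace RestrictedRegression

section SpectralNorm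

lemma quad_le_lambdaMax {d : ℕ} {S : Matrix (Fin d) (Fin d) ℝ} (hS : S.PosSemidef) (u : Fin d → ℝ) :
    u ⬝ᵥ (S *ᵥ u) ≤ lambdaMax S * (u ⬝ᵥ u) := by
  have hH := hS.isHermitian
  have hbdd : BddAbove (spectrum ℝ S) := by
    rw [hH.spectrum_real_eq_range_eigenvalues]
    exact (Set.finite_range _).bddAbove
  have hpsd : (lambdaMax S • (1 : Matrix (Fin d) (Fin d) ℝ) - S).PosSemidef := by
    open scoped MatrixOrder in
    have h : S ≤ algebraMap ℝ _ (lambdaMax S) := by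
      refine (le_algebraMap_iff_spectrum_le (ha := hH)).mpr fun x hx => le_csSup hbdd hx
    rw [Algebra.algebraMap_eq_smul_one] at h
    exact h
  have := quad_mono hpsd u
  rwa [quad_smul, Matrix.one_mulVec] at this

lemma lambdaMax_nonneg {d : ℕ} {S : Matrix (Fin d) (Fin d) ℝ} (hS : S.PosSemidef) :
    0 ≤ lambdaMax S := by
  refine Real.sSup_nonneg fun x hx => ?_
  rw [hS.isHermitian.spectrum_real_eq_range_eigenvalues] at hx
  obtain ⟨i, rfl⟩ := hx
  exact hS.eigenvalues_nonneg i

lemma l2_opNorm_le_of_forall {p d : ℕ} (B : Matrix (Fin p) (Fin d) ℝ) {c : ℝ} (hc : 0 ≤ c)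
    (h : ∀ u : Fin d → ℝ, (B *ᵥ u) ⬝ᵥ (B *ᵥ u) ≤ c ^ 2 * (u ⬝ᵥ u)) : ‖B‖ ≤ c := by
  have key : ∀ {k : ℕ} (u : Fin k → ℝ), u ⬝ᵥ u = ‖WithLp.toLp 2 u‖ ^ 2 := by
    intro k u
    rw [EuclideanSpace.norm_sq_eq]
    simp [dotProduct, pow_two]
  rw [Matrix.l2_opNorm_def]
  refine ContinuousLinearMap.opNorm_le_bound _ hc fun x => ?_
  have := h x.ofLp
  rw [key, key, ← mul_pow] at this
  exact (pow_le_pow_iff_left₀ (norm_nonneg _) (by positivity) two_ne_zero).mp this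

end SpectralNorm

namespace LinearRestriction

variable {q d m r n : ℕ} (L : LinearRestriction q d m r)

lemma kronecker_mulVec_apply {p : ℕ} (M : Matrix (Fin p) (Fin d) ℝ) (w : Fin q × Fin d → ℝ)
    (i : Fin q) (t : Fin p) :
    (((1 : Matrix (Fin q) (Fin q) ℝ) ⊗ₖ M) *ᵥ w) (i, t) = M t ⬝ᵥ fun j => w (i, j) := by
  simp only [Matrix.mulVec, dotProduct, Fintype.sum_prod_type, Matrix.kroneckerMap_apply]
  rw [Finset.sum_eq_single i]
  · simp
  · intro j _ hj
    simp [Matrix.one_apply_ne' hj]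
  · simp

lemma block_mulVec (i : Fin q) (v : Fin m → ℝ) :
    L.block i *ᵥ v = fun j => (L.R *ᵥ v) (i, j) := rfl

lemma design_mulVec_apply (X : Matrix (Fin n) (Fin d) ℝ) (v : Fin m → ℝ) (i : Fin q) (t : Fin n) :
    (L.design X *ᵥ v) (i, t) = X t ⬝ᵥ (L.block i *ᵥ v) := by
  rw [design, ← Matrix.mulVec_mulVec, kronecker_mulVec_apply, block_mulVec]

lemma quad_restrict (Γ : Matrix (Fin d) (Fin d) ℝ) (v : Fin m → ℝ) :
    v ⬝ᵥ (L.restrict Γ *ᵥ v) =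
      ∑ i, (L.block i *ᵥ v) ⬝ᵥ (Γ *ᵥ (L.block i *ᵥ v)) := by
  rw [restrict, ← Matrix.mulVec_mulVec, ← Matrix.mulVec_mulVec, Matrix.dotProduct_mulVec,
    Matrix.vecMul_transpose, dotProduct, Fintype.sum_prod_type]
  refine Finset.sum_congr rfl fun i _ => ?_
  rw [dotProduct]
  refine Finset.sum_congr rfl fun j _ => ?_
  rw [kronecker_mulVec_apply]
  rfl

lemma quad_gram (X : Matrix (Fin n) (Fin d) ℝ) (v : Fin m → ℝ) :
    v ⬝ᵥ (((L.design X)ᵀ * L.design X) *ᵥ v) =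
      ∑ t, ∑ i, (X t ⬝ᵥ (L.block i *ᵥ v)) ^ 2 := by
  rw [dotProduct_transpose_mul_self, dotProduct, Fintype.sum_prod_type_right]
  refine Finset.sum_congr rfl fun t _ => Finset.sum_congr rfl fun i _ => ?_
  rw [design_mulVec_apply, pow_two]

lemma gram_posSemidef (X : Matrix (Fin n) (Fin d) ℝ) :
    ((L.design X)ᵀ * L.design X).PosSemidef := by
  simpa using Matrix.posSemidef_conjTranspose_mul_self (L.design X)

lemma Cplus_mul_R : L.Cplus * L.R = 1 := by
  have h := L.full_mul_inv
  rw [Matrix.fromRows_mul_fromCols, ← Matrix.fromBlocks_one] at h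
  exact (Matrix.fromBlocks_inj.mp h).1

lemma mulVec_R_injective : Function.Injective L.R.mulVec := by
  intro v w h
  have h2 : L.Cplus *ᵥ (L.R *ᵥ v) = L.Cplus *ᵥ (L.R *ᵥ w) := congrArg _ h
  simpa [Matrix.mulVec_mulVec, L.Cplus_mul_R] using h2

lemma restrict_posDef {Γ : Matrix (Fin d) (Fin d) ℝ} (hΓ : Γ.PosDef) : (L.restrict Γ).PosDef := by
  have h := (Matrix.PosDef.kronecker (Matrix.PosDef.one (n := Fin q) (R := ℝ)) hΓ)
  simpa [restrict] using h.conjTranspose_mul_mul_same L.mulVec_R_injective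

lemma restrict_mono {Γ Γ' : Matrix (Fin d) (Fin d) ℝ} (h : (Γ' - Γ).PosSemidef) :
    (L.restrict Γ' - L.restrict Γ).PosSemidef := by
  have hk := Matrix.PosSemidef.kronecker (Matrix.PosSemidef.one (n := Fin q) (R := ℝ)) h
  have h2 := hk.conjTranspose_mul_mul_same L.R
  have h3 : (1 : Matrix (Fin q) (Fin q) ℝ) ⊗ₖ (Γ' - Γ) = 1 ⊗ₖ Γ' - 1 ⊗ₖ Γ := by
    ext ⟨i, j⟩ ⟨i', j'⟩
    simp [mul_sub]
  rw [h3, Matrix.mul_sub, Matrix.sub_mul] at h2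
  simpa [restrict] using h2

/-- The restricted parameter is recovered from its coordinates. -/
lemma vec_eq_of_holds {A : Matrix (Fin q) (Fin d) ℝ} (hA : L.Holds A) :
    Matrix.vec Aᵀ = L.R *ᵥ (L.Cplus *ᵥ Matrix.vec Aᵀ) + L.γ := by
  have h := L.inv_mul_full
  rw [Matrix.fromCols_mul_fromRows] at h
  rw [γ, ← (show L.C *ᵥ Matrix.vec Aᵀ = L.μ from hA), Matrix.mulVec_mulVec, Matrix.mulVec_mulVec,
    ← Matrix.add_mulVec, h, Matrix.one_mulVec]

lemma toMatrix_sub_apply {A : Matrix (Fin q) (Fin d) ℝ} (hA : L.Holds A) (θ : Fin m → ℝ)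
    (i : Fin q) : (L.toMatrix θ - A) i = L.block i *ᵥ (θ - L.Cplus *ᵥ Matrix.vec Aᵀ) := by
  funext j
  have h := congrFun (L.vec_eq_of_holds hA) (i, j)
  have h2 : Matrix.vec Aᵀ (i, j) = A i j := rfl
  rw [block_mulVec, Matrix.mulVec_sub]
  rw [h2] at h
  simp only [Matrix.sub_apply, toMatrix, Matrix.of_apply, Pi.add_apply, Pi.sub_apply] at h ⊢
  linarith

lemma posSemidef_sum_block {Γ : Matrix (Fin m) (Fin m) ℝ} (hΓ : Γ.PosDef) :
    (∑ i, L.block i * Γ⁻¹ * (L.block i)ᵀ).PosSemidef :=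
  Matrix.posSemidef_sum _ fun i _ => by
    simpa using hΓ.inv.posSemidef.mul_mul_conjTranspose_same (L.block i)

/-- The spectral norm of the estimation error in terms of the error of the reduced parameter. -/
lemma norm_toMatrix_sub_le {A : Matrix (Fin q) (Fin d) ℝ} (hA : L.Holds A) (θ : Fin m → ℝ)
    {Γ : Matrix (Fin m) (Fin m) ℝ} (hΓ : Γ.PosDef) {c : ℝ}
    (hc : (θ - L.Cplus *ᵥ Matrix.vec Aᵀ) ⬝ᵥ (Γ *ᵥ (θ - L.Cplus *ᵥ Matrix.vec Aᵀ)) ≤ c) :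
    ‖L.toMatrix θ - A‖ ≤ √(lambdaMax (∑ i, L.block i * Γ⁻¹ * (L.block i)ᵀ) * c) := by
  set Δ := θ - L.Cplus *ᵥ Matrix.vec Aᵀ with hΔ
  set S := ∑ i, L.block i * Γ⁻¹ * (L.block i)ᵀ with hS
  have hSp : S.PosSemidef := L.posSemidef_sum_block hΓ
  have hc0 : 0 ≤ c := (quad_nonneg hΓ.posSemidef Δ).trans hc
  refine l2_opNorm_le_of_forall _ (Real.sqrt_nonneg _) fun u => ?_
  rw [Real.sq_sqrt (mul_nonneg (lambdaMax_nonneg hSp) hc0)]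
  have hrow : ∀ i, ((L.toMatrix θ - A) *ᵥ u) i = ((L.block i)ᵀ *ᵥ u) ⬝ᵥ Δ := by
    intro i
    rw [Matrix.mulVec, L.toMatrix_sub_apply hA, ← hΔ, dotProduct_comm, Matrix.dotProduct_mulVec,
      Matrix.mulVec_transpose]
  have hquad : ∑ i, ((L.block i)ᵀ *ᵥ u) ⬝ᵥ (Γ⁻¹ *ᵥ ((L.block i)ᵀ *ᵥ u)) = u ⬝ᵥ (S *ᵥ u) := by
    rw [hS, Matrix.sum_mulVec, dotProduct_sum]
    refine Finset.sum_congr rfl fun i _ => ?_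
    rw [← Matrix.mulVec_mulVec, ← Matrix.mulVec_mulVec, Matrix.dotProduct_mulVec u,
      ← Matrix.mulVec_transpose]
  calc ((L.toMatrix θ - A) *ᵥ u) ⬝ᵥ ((L.toMatrix θ - A) *ᵥ u)
      = ∑ i, (((L.block i)ᵀ *ᵥ u) ⬝ᵥ Δ) ^ 2 := by
        rw [dotProduct]
        exact Finset.sum_congr rfl fun i _ => by rw [hrow, pow_two]
    _ ≤ ∑ i, ((L.block i)ᵀ *ᵥ u) ⬝ᵥ (Γ⁻¹ *ᵥ ((L.block i)ᵀ *ᵥ u)) * (Δ ⬝ᵥ (Γ *ᵥ Δ)) :=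
        Finset.sum_le_sum fun i _ => dotProduct_sq_le_inv hΓ _ _
    _ = (u ⬝ᵥ (S *ᵥ u)) * (Δ ⬝ᵥ (Γ *ᵥ Δ)) := by rw [← Finset.sum_mul, hquad]
    _ ≤ (lambdaMax S * (u ⬝ᵥ u)) * c :=
        mul_le_mul (quad_le_lambdaMax hSp u) hc (quad_nonneg hΓ.posSemidef Δ)
          (mul_nonneg (lambdaMax_nonneg hSp) (by
            have := quad_nonneg (Matrix.PosSemidef.one (n := Fin d) (R := ℝ)) u
            rwa [Matrix.one_mulVec] at this))
    _ = lambdaMax S * c * (u ⬝ᵥ u) := by ring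

/-- The basic inequality of least squares. -/
lemma quad_gram_le_of_isOLS {X : Matrix (Fin n) (Fin d) ℝ} {Y H : Matrix (Fin n) (Fin q) ℝ}
    {A : Matrix (Fin q) (Fin d) ℝ} (hA : L.Holds A) (hY : ∀ t, Y t = A *ᵥ X t + H t)
    {θ : Fin m → ℝ} (hθ : L.IsOLS X Y θ) :
    (θ - L.Cplus *ᵥ Matrix.vec Aᵀ) ⬝ᵥ (((L.design X)ᵀ * L.design X) *ᵥ
        (θ - L.Cplus *ᵥ Matrix.vec Aᵀ)) ≤
      2 * ((θ - L.Cplus *ᵥ Matrix.vec Aᵀ) ⬝ᵥ ((L.design X)ᵀ *ᵥ Matrix.vec H)) := by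
  set θ₀ := L.Cplus *ᵥ Matrix.vec Aᵀ with hθ₀
  set Δ := θ - θ₀ with hΔ
  have hresp : L.response X Y = L.design X *ᵥ θ₀ + Matrix.vec H := by
    have h1 : Matrix.vec Y = ((1 : Matrix (Fin q) (Fin q) ℝ) ⊗ₖ X) *ᵥ Matrix.vec Aᵀ +
        Matrix.vec H := by
      funext ⟨i, t⟩
      rw [Pi.add_apply, kronecker_mulVec_apply]
      have := congrFun (hY t) i
      rw [Pi.add_apply, Matrix.mulVec, dotProduct_comm] at this
      exact this
    rw [response, h1, L.vec_eq_of_holds hA, ← hθ₀, Matrix.mulVec_add, design,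
      Matrix.mulVec_mulVec]
    abel
  have h0 : L.rss X Y θ₀ = Matrix.vec H ⬝ᵥ Matrix.vec H := by
    simp [rss, hresp, dotProduct, pow_two]
  have h1 : L.rss X Y θ =
      (Matrix.vec H - L.design X *ᵥ Δ) ⬝ᵥ (Matrix.vec H - L.design X *ᵥ Δ) := by
    rw [rss, dotProduct, hresp]
    refine Finset.sum_congr rfl fun p _ => ?_
    simp only [hΔ, Matrix.mulVec_sub, Pi.add_apply, Pi.sub_apply]
    ring
  have h2 := hθ θ₀
  rw [h0, h1, sub_dotProduct, dotProduct_sub, dotProduct_sub,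
    dotProduct_comm (Matrix.vec H) (L.design X *ᵥ Δ)] at h2
  rw [dotProduct_transpose_mul_self, Matrix.dotProduct_mulVec Δ, Matrix.vecMul_transpose]
  linarith

end LinearRestriction
end RestrictedRegression

namespace RestrictedRegression

section History

variable {Ω : Type*} {d q : ℕ} {X : ℕ → Ω → Fin d → ℝ} {η : ℕ → Ω → Fin q → ℝ}

lemma history_mono : Monotone (history X η) := by
  intro s t hst
  refine sup_le_sup (iSup_le fun i => ?_) (iSup_le fun i => ?_)
  · exact le_iSup (fun s : {s : ℕ // 1 ≤ s ∧ s < t} => MeasurableSpace.comap (η s) inferInstance)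
      ⟨i, i.2.1, i.2.2.trans_le hst⟩
  · exact le_iSup (fun s : {s : ℕ // 1 ≤ s ∧ s ≤ t} => MeasurableSpace.comap (X s) inferInstance)
      ⟨i, i.2.1, i.2.2.trans hst⟩

lemma history_le [m0 : MeasurableSpace Ω] (hX : ∀ t, 1 ≤ t → Measurable (X t))
    (hη : ∀ t, 1 ≤ t → Measurable (η t)) (t : ℕ) : history X η t ≤ m0 :=
  sup_le (iSup_le fun i => (hη i i.2.1).comap_le) (iSup_le fun i => (hX i i.2.1).comap_le)

lemma measurable_history_covariate {t : ℕ} (ht : 1 ≤ t) : Measurable[history X η t] (X t) := by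
  refine Measurable.of_comap_le (le_sup_of_le_right ?_)
  exact le_iSup (fun s : {s : ℕ // 1 ≤ s ∧ s ≤ t} => MeasurableSpace.comap (X s) inferInstance)
    ⟨t, ht, le_rfl⟩

lemma measurable_history_error {t : ℕ} (ht : 1 ≤ t) :
    Measurable[history X η (t + 1)] (η t) := by
  refine Measurable.of_comap_le (le_sup_of_le_left ?_)
  exact le_iSup (fun s : {s : ℕ // 1 ≤ s ∧ s < t + 1} =>
    MeasurableSpace.comap (η s) inferInstance) ⟨t, ht, t.lt_succ_self⟩

end History

section Regression

variable {Ω : Type*} [MeasurableSpace Ω] {P : Measure Ω} [IsProbabilityMeasure P]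
  {d q m r k : ℕ} {X : ℕ → Ω → Fin d → ℝ} {η : ℕ → Ω → Fin q → ℝ}

omit [IsProbabilityMeasure P] in
/-- The block small ball condition in an arbitrary direction, not necessarily of unit length. -/
lemma BMSB.ae_le {F : ℕ → MeasurableSpace Ω} {Γ : Matrix (Fin d) (Fin d) ℝ} {α : ℝ}
    (h : BMSB P F X k Γ α) {b : Fin d → ℝ} (hb : b ≠ 0) (s : ℕ) :
    ∀ᵐ ω ∂P, α ≤ (k : ℝ)⁻¹ * ∑ t ∈ Finset.Icc 1 k,
      condProb P (F s) {ω' | √(b ⬝ᵥ (Γ *ᵥ b)) ≤ |b ⬝ᵥ X (s + t) ω'|} ω := by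
  obtain ⟨-, -, -, -, h⟩ := h
  have hbb : 0 < b ⬝ᵥ b := by
    have := quad_pos (Matrix.PosDef.one (n := Fin d) (R := ℝ)) hb
    rwa [Matrix.one_mulVec] at this
  set l := √(b ⬝ᵥ b) with hl
  have hl0 : 0 < l := Real.sqrt_pos.mpr hbb
  have hl2 : l ^ 2 = b ⬝ᵥ b := Real.sq_sqrt hbb.le
  have hu : (l⁻¹ • b) ⬝ᵥ (l⁻¹ • b) = 1 := by
    rw [dotProduct_smul, smul_dotProduct, smul_eq_mul, smul_eq_mul, ← hl2]
    field_simp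
  obtain ⟨-, -, -, -, -, h6⟩ := h _ hu
  have hset : ∀ t, {ω' | √((l⁻¹ • b) ⬝ᵥ (Γ *ᵥ (l⁻¹ • b))) ≤ |(l⁻¹ • b) ⬝ᵥ X (s + t) ω'|} =
      {ω' | √(b ⬝ᵥ (Γ *ᵥ b)) ≤ |b ⬝ᵥ X (s + t) ω'|} := by
    intro t
    ext ω'
    simp only [Set.mem_ofPred_eq]
    rw [quad_smul_vec, Real.sqrt_mul (by positivity), Real.sqrt_sq (by positivity),
      smul_dotProduct, smul_eq_mul, abs_mul, abs_of_pos (inv_pos.mpr hl0)]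
    exact mul_le_mul_iff_right₀ (inv_pos.mpr hl0)
  have := h6 s
  simp only [hset] at this
  exact this

/-- A pointwise lower tail bound for the Gram matrix of the restricted regression. -/
lemma measure_quad_gram_lt_le (hX : ∀ t, 1 ≤ t → Measurable (X t))
    (hη : ∀ t, 1 ≤ t → Measurable (η t)) (L : LinearRestriction q d m r)
    {Γ : Matrix (Fin d) (Fin d) ℝ} {α : ℝ} (h : BMSB P (history X η) X k Γ α) (n : ℕ)
    (v : Fin m → ℝ) :
    P {ω | v ⬝ᵥ (((L.design (dataMatrix X n ω))ᵀ * L.design (dataMatrix X n ω)) *ᵥ v) <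
        ((n / k * k : ℕ) : ℝ) * α / 8 * (v ⬝ᵥ (L.restrict Γ *ᵥ v))} ≤
      ENNReal.ofReal (Real.exp (-(3 / 8 * ((n / k : ℕ) * α)))) := by
  have hk : 1 ≤ k := h.1
  have hΓ : Γ.PosDef := h.2.2.2.1
  by_cases hv : v = 0
  · simp [hv]
  set Q := v ⬝ᵥ (L.restrict Γ *ᵥ v) with hQ
  have hQ0 : 0 < Q := quad_pos (L.restrict_posDef hΓ) hv
  set b : Fin q → Fin d → ℝ := fun i => L.block i *ᵥ v with hb
  set c : Fin q → ℝ := fun i => b i ⬝ᵥ (Γ *ᵥ b i) with hc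
  have hc0 : ∀ i, 0 ≤ c i := fun i => quad_nonneg hΓ.posSemidef _
  have hcQ : ∑ i, c i / Q = 1 := by
    rw [← Finset.sum_div, ← L.quad_restrict, div_self hQ0.ne']
  have hw0 : ∀ i, 0 ≤ c i / Q := fun i => div_nonneg (hc0 i) hQ0.le
  set B : Fin q → ℕ → Set Ω := fun i t => {ω | √(c i) ≤ |b i ⬝ᵥ X t ω|} with hB
  set e : Fin q → ℕ → Ω → ℝ := fun i t => (B i t).indicator (fun _ => (1 : ℝ)) with he
  have he0 : ∀ i t ω, 0 ≤ e i t ω := fun i t ω =>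
    Set.indicator_nonneg (fun _ _ => zero_le_one) ω
  have he1 : ∀ i t ω, e i t ω ≤ 1 := fun i t ω =>
    Set.indicator_le_self' (fun _ _ => zero_le_one) ω
  have hBm : ∀ i t, 1 ≤ t → MeasurableSet[history X η t] (B i t) := by
    intro i t ht
    have hcont : Continuous fun x : Fin d → ℝ => |b i ⬝ᵥ x| := by fun_prop
    exact (hcont.measurable.comp (measurable_history_covariate ht)) measurableSet_Ici
  have hem : ∀ i t, 1 ≤ t → Measurable[history X η t] (e i t) := fun i t ht =>
    Measurable.indicator measurable_const (hBm i t ht)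
  have hei : ∀ i t, 1 ≤ t → Integrable (e i t) P := fun i t ht =>
    (integrable_const (1 : ℝ)).indicator (history_le hX hη t _ (hBm i t ht))
  set a : ℕ → Ω → ℝ := fun t ω => ∑ i, c i / Q * e i t ω with ha
  have hcond : ∀ s, ∀ᵐ ω ∂P, α ≤
      (P[fun ω => (k : ℝ)⁻¹ * ∑ t ∈ Finset.Icc 1 k, a (s + t) ω | history X η s]) ω := by
    intro s
    have hfun : (fun ω => (k : ℝ)⁻¹ * ∑ t ∈ Finset.Icc 1 k, a (s + t) ω) =
        ∑ i, (c i / Q * (k : ℝ)⁻¹) • ∑ t ∈ Finset.Icc 1 k, e i (s + t) := by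
      funext ω
      simp only [ha, Finset.sum_apply, Pi.smul_apply, smul_eq_mul]
      rw [Finset.sum_comm, Finset.mul_sum]
      refine Finset.sum_congr rfl fun i _ => ?_
      rw [← Finset.mul_sum]
      ring
    have hit : ∀ i, ∀ t ∈ Finset.Icc 1 k, Integrable (e i (s + t)) P := fun i t ht =>
      hei i _ (by rw [Finset.mem_Icc] at ht; omega)
    have h1 := condExp_finsetSum (μ := P) (s := Finset.univ)
      (f := fun i => (c i / Q * (k : ℝ)⁻¹) • ∑ t ∈ Finset.Icc 1 k, e i (s + t))
      (fun i _ => (integrable_finsetSum' _ (hit i)).smul _) (history X η s)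
    have h2 : ∀ᵐ ω ∂P, ∀ i, (P[(c i / Q * (k : ℝ)⁻¹) • ∑ t ∈ Finset.Icc 1 k, e i (s + t) |
        history X η s]) ω = c i / Q * (k : ℝ)⁻¹ *
          (P[∑ t ∈ Finset.Icc 1 k, e i (s + t) | history X η s]) ω :=
      ae_all_iff.mpr fun i => by
        filter_upwards [condExp_smul (μ := P) (c i / Q * (k : ℝ)⁻¹)
          (∑ t ∈ Finset.Icc 1 k, e i (s + t)) (history X η s)] with ω hω
        rw [hω, Pi.smul_apply, smul_eq_mul]
    have h3 : ∀ᵐ ω ∂P, ∀ i, (P[∑ t ∈ Finset.Icc 1 k, e i (s + t) | history X η s]) ω =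
        ∑ t ∈ Finset.Icc 1 k, condProb P (history X η s) (B i (s + t)) ω :=
      ae_all_iff.mpr fun i => by
        filter_upwards [condExp_finsetSum (hit i) (history X η s)] with ω hω
        rw [hω, Finset.sum_apply]
        rfl
    have h4 : ∀ᵐ ω ∂P, ∀ i, c i / Q * α ≤ c i / Q * ((k : ℝ)⁻¹ *
        ∑ t ∈ Finset.Icc 1 k, condProb P (history X η s) (B i (s + t)) ω) :=
      ae_all_iff.mpr fun i => by
        by_cases hbi : b i = 0
        · have hci : c i = 0 := by simp [hc, hbi]
          simp [hci]
        · filter_upwards [h.ae_le hbi s] with ω hω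
          exact mul_le_mul_of_nonneg_left hω (hw0 i)
    rw [hfun]
    filter_upwards [h1, h2, h3, h4] with ω e1 e2 e3 e4
    rw [e1, Finset.sum_apply]
    calc α = ∑ i, c i / Q * α := by rw [← Finset.sum_mul, hcQ, one_mul]
      _ ≤ _ := Finset.sum_le_sum fun i _ => by
        rw [e2, e3, mul_assoc]
        exact e4 i
  refine (measure_mono fun ω hω => ?_).trans (measure_sum_le_of_block_condExp_ge (history X η)
    (history_le hX hη) history_mono (a := a)
    (fun t ht => Finset.measurable_fun_sum _ fun i _ => (hem i t ht).const_mul _)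
    (fun t ω => Finset.sum_nonneg fun i _ => mul_nonneg (hw0 i) (he0 i t ω))
    (fun t ω => (Finset.sum_le_sum fun i _ =>
      mul_le_of_le_one_right (hw0 i) (he1 i t ω)).trans hcQ.le) hk hcond n)
  replace hω : v ⬝ᵥ (((L.design (dataMatrix X n ω))ᵀ * L.design (dataMatrix X n ω)) *ᵥ v) <
    ((n / k * k : ℕ) : ℝ) * α / 8 * Q := hω
  show ∑ t ∈ Finset.range n, a (t + 1) ω ≤ ((n / k * k : ℕ) : ℝ) * α / 8
  have hge : Q * ∑ t ∈ Finset.range n, a (t + 1) ω ≤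
      v ⬝ᵥ (((L.design (dataMatrix X n ω))ᵀ * L.design (dataMatrix X n ω)) *ᵥ v) := by
    rw [L.quad_gram, Finset.mul_sum, Finset.sum_range]
    refine Finset.sum_le_sum fun t _ => ?_
    rw [ha, Finset.mul_sum]
    refine Finset.sum_le_sum fun i _ => ?_
    rw [← mul_assoc, mul_div_cancel₀ _ hQ0.ne']
    show c i * e i (t + 1) ω ≤ (X (t + 1) ω ⬝ᵥ b i) ^ 2
    by_cases hi : ω ∈ B i (t + 1)
    · rw [he]
      dsimp only
      rw [Set.indicator_of_mem hi, mul_one, dotProduct_comm, ← sq_abs]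
      exact (Real.sqrt_le_left (abs_nonneg _)).mp hi
    · rw [he]
      dsimp only
      rw [Set.indicator_of_notMem hi, mul_zero]
      positivity
  exact (lt_of_mul_lt_mul_left (by linarith) hQ0.le).le

lemma measurable_design_apply (hX : ∀ t, 1 ≤ t → Measurable (X t)) (L : LinearRestriction q d m r)
    {n : ℕ} (p : Fin q × Fin n) (i : Fin m) :
    Measurable fun ω => L.design (dataMatrix X n ω) p i := by
  simp only [LinearRestriction.design, Matrix.mul_apply, Matrix.kroneckerMap_apply]
  refine Finset.measurable_fun_sum _ fun j _ => (Measurable.const_mul ?_ _).mul_const _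
  exact (measurable_pi_apply j.2).comp (hX (p.2 + 1) (by omega))

lemma measurable_gram_apply (hX : ∀ t, 1 ≤ t → Measurable (X t)) (L : LinearRestriction q d m r)
    (n : ℕ) (i j : Fin m) : Measurable fun ω =>
      ((L.design (dataMatrix X n ω))ᵀ * L.design (dataMatrix X n ω)) i j := by
  simp only [Matrix.mul_apply, Matrix.transpose_apply]
  exact Finset.measurable_fun_sum _ fun p _ =>
    (measurable_design_apply hX L p i).mul (measurable_design_apply hX L p j)

lemma measurable_score (hX : ∀ t, 1 ≤ t → Measurable (X t)) (hη : ∀ t, 1 ≤ t → Measurable (η t))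
    (L : LinearRestriction q d m r) (n : ℕ) : Measurable fun ω =>
      (L.design (dataMatrix X n ω))ᵀ *ᵥ Matrix.vec (dataMatrix η n ω) := by
  refine measurable_pi_lambda _ fun i => ?_
  simp only [Matrix.mulVec, dotProduct, Matrix.transpose_apply]
  refine Finset.measurable_fun_sum _ fun p _ => (measurable_design_apply hX L p i).mul ?_
  exact (measurable_pi_apply p.1).comp (hη (p.2 + 1) (by omega))

lemma lintegral_exp_score_le_one (hX : ∀ t, 1 ≤ t → Measurable (X t))
    (hη : ∀ t, 1 ≤ t → Measurable (η t)) (L : LinearRestriction q d m r) {σ : ℝ}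
    (hsub : ∀ t, 1 ≤ t → CondSubGaussian P (history X η t) (η t) σ) (n : ℕ) (w : Fin m → ℝ) :
    ∫⁻ ω, ENNReal.ofReal (Real.exp (w ⬝ᵥ ((L.design (dataMatrix X n ω))ᵀ *ᵥ
        Matrix.vec (dataMatrix η n ω)) - 1 / 2 * (w ⬝ᵥ ((σ ^ 2 •
          ((L.design (dataMatrix X n ω))ᵀ * L.design (dataMatrix X n ω))) *ᵥ w)))) ∂P ≤ 1 := by
  set v : ℕ → Ω → Fin q → ℝ := fun t ω i => X t ω ⬝ᵥ (L.block i *ᵥ w) with hv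
  have hvm : ∀ t, 1 ≤ t → Measurable[history X η t] (v t) := by
    intro t ht
    have hcont : Continuous fun x : Fin d → ℝ => fun i => x ⬝ᵥ (L.block i *ᵥ w) := by fun_prop
    exact hcont.measurable.comp (measurable_history_covariate ht)
  refine le_trans (le_of_eq (lintegral_congr fun ω => ?_)) (lintegral_exp_sum_le_one (history X η)
    (history_le hX hη) history_mono (fun t ht => measurable_history_error ht) hsub hvm n)
  congr 2
  rw [quad_smul, L.quad_gram, Matrix.dotProduct_mulVec, Matrix.vecMul_transpose, dotProduct,
    Fintype.sum_prod_type_right, Finset.sum_sub_distrib, Finset.sum_range, ← Finset.mul_sum,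
    Finset.sum_range, ← mul_assoc]
  congr 1
  · refine Finset.sum_congr rfl fun t _ => Finset.sum_congr rfl fun i _ => ?_
    rw [L.design_mulVec_apply]
    rfl
  · congr 1
    · ring
    · refine Finset.sum_congr rfl fun t _ => Finset.sum_congr rfl fun i _ => ?_
      rw [pow_two]
      rfl

end Regression
end RestrictedRegression

namespace RestrictedRegression

section SampleSize

lemma one_le_log_div {a α : ℝ} (ha : 3 ≤ a) (hα0 : 0 < α) (hα1 : α < 1) :
    1 ≤ Real.log (a / α) := by
  rw [Real.le_log_iff_exp_le (by positivity)]
  have h1 : Real.exp 1 < 3 := Real.exp_one_lt_d9.trans (by norm_num)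
  rw [le_div_iff₀ hα0]
  nlinarith [Real.exp_pos 1]

lemma le_div_mul_of_sample_size {n m k : ℕ} {α b c : ℝ} (hα0 : 0 < α) (hα1 : α < 1) (hk : 1 ≤ k)
    (hm : 1 ≤ m) (hb : 0 ≤ b) (hc : 0 ≤ c)
    (hn : 9 * (k : ℝ) / α ^ 2 * (m * Real.log (27 / α) + b + c) ≤ n) :
    8 / 9 * (n : ℝ) ≤ ((n / k * k : ℕ) : ℝ) ∧
      m * Real.log (27 / α) + b ≤ 3 / 8 * (((n / k : ℕ) : ℝ) * α) := by
  have hk0 : (0 : ℝ) < k := by exact_mod_cast hk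
  have hm1 : (1 : ℝ) ≤ m := by exact_mod_cast hm
  have hlog : 1 ≤ Real.log (27 / α) := one_le_log_div (by norm_num) hα0 hα1
  set B := m * Real.log (27 / α) + b with hB
  have hB1 : 1 ≤ B := by nlinarith
  have hα2 : 0 < α ^ 2 := by positivity
  have h1 : 9 * (k : ℝ) * B ≤ n * α ^ 2 := by
    rw [div_mul_eq_mul_div, div_le_iff₀ hα2] at hn
    nlinarith [mul_nonneg hk0.le hc]
  have hα3 : α ^ 2 ≤ α := by nlinarith
  have hn0 : (0 : ℝ) ≤ n := n.cast_nonneg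
  have h2 : (9 * k : ℝ) ≤ n := by nlinarith
  have h2' : k * 9 ≤ n := by rw [mul_comm]; exact_mod_cast h2
  have hT : 9 ≤ n / k := (Nat.le_div_iff_mul_le hk).mpr (by omega)
  have hT' : (9 : ℝ) ≤ (n / k : ℕ) := by exact_mod_cast hT
  have h3 : (n : ℝ) < ((n / k : ℕ) + 1) * k := by
    have := Nat.lt_div_mul_add (a := n) hk
    have h : (n : ℝ) < ((n / k * k + k : ℕ) : ℝ) := by exact_mod_cast this
    push_cast at h ⊢
    linarith
  set T : ℝ := ((n / k : ℕ) : ℝ) with hTdef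
  have h4 : 8 / 9 * (n : ℝ) ≤ T * k := by nlinarith
  refine ⟨by push_cast; exact h4, ?_⟩
  have h5 : 9 * (k : ℝ) * B ≤ 9 / 8 * (T * k) * α := by
    calc 9 * (k : ℝ) * B ≤ n * α ^ 2 := h1
      _ ≤ n * α := by gcongr
      _ ≤ 9 / 8 * (T * k) * α := by gcongr; linarith
  have h6 : 9 * B ≤ 9 / 8 * T * α := by
    refine le_of_mul_le_mul_left ?_ hk0
    linarith
  have : 0 ≤ T * α := by positivity
  linarith

end SampleSize

section Regression

variable {Ω : Type*} [MeasurableSpace Ω] {P : Measure Ω} [IsProbabilityMeasure P]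
  {d q m r k : ℕ} {X : ℕ → Ω → Fin d → ℝ} {η : ℕ → Ω → Fin q → ℝ}

/-- The Gram matrix is bounded below with high probability. -/
lemma measure_exists_quad_gram_lt_le (hX : ∀ t, 1 ≤ t → Measurable (X t))
    (hη : ∀ t, 1 ≤ t → Measurable (η t)) (L : LinearRestriction q d m r)
    {Γ Γ' : Matrix (Fin d) (Fin d) ℝ} (hΓ' : Γ'.PosDef) (hle : (Γ' - Γ).PosSemidef) {α : ℝ}
    (h : BMSB P (history X η) X k Γ α) {n : ℕ} (hn0 : 0 < n) {δ : ℝ} (hδ0 : 0 < δ)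
    (hn : 8 / 9 * (n : ℝ) ≤ ((n / k * k : ℕ) : ℝ))
    (hn' : m * Real.log (27 / α) + (1 / 2 * Real.log ((L.restrict Γ').det / (L.restrict Γ).det) +
      Real.log (1 / δ)) ≤ 3 / 8 * (((n / k : ℕ) : ℝ) * α)) :
    P {ω | ((n : ℝ) • L.restrict Γ' -
          (L.design (dataMatrix X n ω))ᵀ * L.design (dataMatrix X n ω)).PosSemidef ∧
        ∃ w : Fin m → ℝ, w ⬝ᵥ (((L.design (dataMatrix X n ω))ᵀ *
          L.design (dataMatrix X n ω)) *ᵥ w) <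
            9 / 16 * (w ⬝ᵥ (((n * α ^ 2 / 9 : ℝ) • L.restrict Γ) *ᵥ w))} ≤
      ENNReal.ofReal δ := by
  have hα0 : 0 < α := h.2.1
  have hα1 : α < 1 := h.2.2.1
  have hΓ : Γ.PosDef := h.2.2.2.1
  have hn0' : (0 : ℝ) < n := by exact_mod_cast hn0
  have hR := L.restrict_posDef hΓ
  have hR' := L.restrict_posDef hΓ'
  have hd := hR.det_pos
  have hd' := hR'.det_pos
  have hM : ((n * α ^ 2 / 9 : ℝ) • L.restrict Γ).PosDef := hR.smul (by positivity)
  have hN : ((n : ℝ) • L.restrict Γ').PosDef := hR'.smul hn0'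
  have hMN : ((n : ℝ) • L.restrict Γ' - (n * α ^ 2 / 9 : ℝ) • L.restrict Γ).PosSemidef := by
    have e : (n : ℝ) • L.restrict Γ' - (n * α ^ 2 / 9 : ℝ) • L.restrict Γ =
        (n : ℝ) • (L.restrict Γ' - L.restrict Γ) + (n * (1 - α ^ 2 / 9) : ℝ) • L.restrict Γ := by
      module
    rw [e]
    refine ((L.restrict_mono hle).smul hn0'.le).add (hR.posSemidef.smul ?_)
    have : α ^ 2 ≤ 1 := by nlinarith
    exact mul_nonneg hn0'.le (by linarith)
  refine (measure_exists_quad_lt_le (p := ENNReal.ofReal (Real.exp (-(3 / 8 * ((n / k : ℕ) * α)))))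
    (measurable_gram_apply hX L n) (fun ω => L.gram_posSemidef _) hM hN hMN fun v => ?_).trans ?_
  · refine (measure_mono fun ω hω => ?_).trans (measure_quad_gram_lt_le hX hη L h n v)
    refine lt_of_lt_of_le (show v ⬝ᵥ (((L.design (dataMatrix X n ω))ᵀ *
      L.design (dataMatrix X n ω)) *ᵥ v) < v ⬝ᵥ (((n * α ^ 2 / 9 : ℝ) • L.restrict Γ) *ᵥ v)
      from hω) ?_
    rw [quad_smul]
    refine mul_le_mul_of_nonneg_right ?_ (quad_nonneg hR.posSemidef v)
    have : α ^ 2 ≤ α := by nlinarith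
    nlinarith
  · rw [← ENNReal.ofReal_mul (Real.exp_pos _).le]
    refine ENNReal.ofReal_le_ofReal ?_
    set D := (L.restrict Γ').det / (L.restrict Γ).det with hD
    have hD0 : 0 < D := div_pos hd' hd
    have hdet : ((n : ℝ) • L.restrict Γ').det / ((n * α ^ 2 / 9 : ℝ) • L.restrict Γ).det =
        ((3 / α) ^ m) ^ 2 * D := by
      rw [Matrix.det_smul, Matrix.det_smul, Fintype.card_fin, mul_div_mul_comm, ← div_pow,
        ← pow_mul, mul_comm m 2, pow_mul]
      congr 2
      field_simp
      norm_num
    have hexp : 9 ^ m * √(((n : ℝ) • L.restrict Γ').det /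
        ((n * α ^ 2 / 9 : ℝ) • L.restrict Γ).det) =
        Real.exp (m * Real.log (27 / α) + 1 / 2 * Real.log D) := by
      rw [hdet, Real.sqrt_mul (by positivity), Real.sqrt_sq (by positivity), Real.exp_add,
        Real.exp_nat_mul, Real.exp_log (by positivity), Real.sqrt_eq_rpow,
        Real.rpow_def_of_pos hD0, ← mul_assoc, ← mul_pow, mul_comm (Real.log D)]
      congr 2
      ring
    rw [hexp, ← Real.exp_add]
    calc _ ≤ Real.exp (-Real.log (1 / δ)) := Real.exp_le_exp.mpr (by linarith)
      _ = δ := by rw [one_div, Real.log_inv, neg_neg, Real.exp_log hδ0]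

/-- The self-normalized score is bounded with high probability. -/
lemma measure_exists_score_lt_le (hX : ∀ t, 1 ≤ t → Measurable (X t))
    (hη : ∀ t, 1 ≤ t → Measurable (η t)) (L : LinearRestriction q d m r) {σ : ℝ} (hσ : 0 < σ)
    (hsub : ∀ t, 1 ≤ t → CondSubGaussian P (history X η t) (η t) σ)
    {Γ Γ' : Matrix (Fin d) (Fin d) ℝ} (hΓ : Γ.PosDef) (hΓ' : Γ'.PosDef)
    (hle : (Γ' - Γ).PosSemidef) {α : ℝ} (hα0 : 0 < α) (hα1 : α < 1) {n : ℕ} (hn0 : 0 < n)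
    {δ : ℝ} (hδ0 : 0 < δ) :
    P {ω | ((n : ℝ) • L.restrict Γ' -
          (L.design (dataMatrix X n ω))ᵀ * L.design (dataMatrix X n ω)).PosSemidef ∧
        ∃ w : Fin m → ℝ, Real.log (1 / δ) + m * Real.log (14 / α) +
          1 / 2 * Real.log ((L.restrict Γ').det / (L.restrict Γ).det) <
            w ⬝ᵥ ((L.design (dataMatrix X n ω))ᵀ *ᵥ Matrix.vec (dataMatrix η n ω)) -
              σ ^ 2 / 2 * (w ⬝ᵥ (((L.design (dataMatrix X n ω))ᵀ *
                L.design (dataMatrix X n ω)) *ᵥ w) +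
                n * α ^ 2 / 16 * (w ⬝ᵥ (L.restrict Γ *ᵥ w)))} ≤
      ENNReal.ofReal δ := by
  have hn0' : (0 : ℝ) < n := by exact_mod_cast hn0
  have hR := L.restrict_posDef hΓ
  have hR' := L.restrict_posDef hΓ'
  have hd := hR.det_pos
  have hd' := hR'.det_pos
  have hV : ((σ ^ 2 * (n * α ^ 2 / 16) : ℝ) • L.restrict Γ).PosDef := hR.smul (by positivity)
  have hN : ((σ ^ 2 * (n * (17 / 16)) : ℝ) • L.restrict Γ').PosDef := hR'.smul (by positivity)
  refine (measure_mono ?_).trans (measure_exists_mixture_lt_le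
    (G := fun ω => σ ^ 2 • ((L.design (dataMatrix X n ω))ᵀ * L.design (dataMatrix X n ω)))
    (fun i j => (measurable_gram_apply hX L n i j).const_mul _) (measurable_score hX hη L n)
    (fun ω => (L.gram_posSemidef _).smul (sq_nonneg σ))
    (lintegral_exp_score_le_one hX hη L hsub n) hV hN hδ0)
  rintro ω ⟨hψ, w, hw⟩
  set G := (L.design (dataMatrix X n ω))ᵀ * L.design (dataMatrix X n ω) with hG
  have hα2 : α ^ 2 ≤ 1 := by nlinarith
  refine ⟨?_, w, ?_⟩
  · have e : (σ ^ 2 * (n * (17 / 16)) : ℝ) • L.restrict Γ' -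
        (σ ^ 2 • G + (σ ^ 2 * (n * α ^ 2 / 16) : ℝ) • L.restrict Γ) =
        σ ^ 2 • ((n : ℝ) • L.restrict Γ' - G) +
          ((σ ^ 2 * n / 16 : ℝ) • (L.restrict Γ' - L.restrict Γ) +
            (σ ^ 2 * n / 16 * (1 - α ^ 2) : ℝ) • L.restrict Γ) := by
      module
    rw [e]
    refine (hψ.smul (sq_nonneg σ)).add (((L.restrict_mono hle).smul (by positivity)).add
      (hR.posSemidef.smul ?_))
    exact mul_nonneg (by positivity) (by linarith)
  · rw [Matrix.add_mulVec, dotProduct_add, quad_smul, quad_smul]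
    refine lt_of_le_of_lt ?_ (hw.trans_eq (by ring))
    set D := (L.restrict Γ').det / (L.restrict Γ).det with hD
    have hD0 : 0 < D := div_pos hd' hd
    have hdet : ((σ ^ 2 * (n * (17 / 16)) : ℝ) • L.restrict Γ').det /
        ((σ ^ 2 * (n * α ^ 2 / 16) : ℝ) • L.restrict Γ).det = (17 / α ^ 2) ^ m * D := by
      rw [Matrix.det_smul, Matrix.det_smul, Fintype.card_fin, mul_div_mul_comm, ← div_pow]
      congr 2
      field_simp
    have hlog : Real.log (17 / α ^ 2) ≤ 2 * Real.log (14 / α) := by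
      rw [← Real.log_rpow (by positivity)]
      refine Real.log_le_log (by positivity) ?_
      rw [Real.rpow_two, div_pow]
      gcongr
      norm_num
    rw [hdet, Real.log_mul (by positivity) hD0.ne', Real.log_pow]
    have := mul_le_mul_of_nonneg_left hlog (Nat.cast_nonneg (α := ℝ) m)
    linarith

end Regression

/-- The deterministic part of the error bound. -/
lemma quad_le_of_basic_inequality {σ α N K g h s : ℝ} (hσ : 0 < σ) (hα : 0 < α) (hN : 0 < N)
    (hs : g ≤ 2 * s) (hlow : N * α ^ 2 / 16 * h ≤ g)
    (hK : ∀ c : ℝ, c * s - σ ^ 2 / 2 * (c ^ 2 * g + N * α ^ 2 / 16 * (c ^ 2 * h)) ≤ K) :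
    h ≤ 256 * σ ^ 2 * K / (N * α ^ 2) := by
  have h1 := hK (1 / (4 * σ ^ 2))
  have h2 : g ≤ 16 * σ ^ 2 * K := by
    have e : 1 / (4 * σ ^ 2) * s - σ ^ 2 / 2 * ((1 / (4 * σ ^ 2)) ^ 2 * g +
        N * α ^ 2 / 16 * ((1 / (4 * σ ^ 2)) ^ 2 * h)) =
        (8 * s - g - N * α ^ 2 / 16 * h) / (32 * σ ^ 2) := by
      field_simp
      ring
    rw [e, div_le_iff₀ (by positivity)] at h1
    linarith
  rw [le_div_iff₀ (by positivity)]
  linarith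

end RestrictedRegression

theorem proposition1 {Ω : Type*} [MeasurableSpace Ω] (P : Measure Ω) [IsProbabilityMeasure P]
    (n d q m r k : ℕ)
    -- covariates, responses and errors; only the indices `t ≥ 1` are used
    (X : ℕ → Ω → Fin d → ℝ) (Y η : ℕ → Ω → Fin q → ℝ)
    (hX : ∀ t, 1 ≤ t → Measurable (X t)) (hη : ∀ t, 1 ≤ t → Measurable (η t))
    -- the linearly restricted stochastic regression model
    (A : Matrix (Fin q) (Fin d) ℝ)
    (hmodel : ∀ t, 1 ≤ t → t ≤ n → ∀ᵐ ω ∂P, Y t ω = A *ᵥ X t ω + η t ω)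
    (L : RestrictedRegression.LinearRestriction q d m r) (hA : L.Holds A)
    (δ α σ : ℝ) (hδ0 : 0 < δ) (hδ1 : δ < 1) (hσ : 0 < σ)
    (Γsb Γbar : Matrix (Fin d) (Fin d) ℝ)
    -- small ball condition on the covariates
    (hbmsb : RestrictedRegression.BMSB P (RestrictedRegression.history X η) X k Γsb α)
    -- upper bound on the Gram matrix, at the level `δ`
    (hΓbar : Γbar.PosDef)
    (hupper : P {ω | ¬ ((n : ℝ) • L.restrict Γbar -
        (L.design (RestrictedRegression.dataMatrix X n ω))ᵀ *
          L.design (RestrictedRegression.dataMatrix X n ω)).PosSemidef} ≤ ENNReal.ofReal δ)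
    -- conditionally sub-Gaussian errors
    (hsub : ∀ t, 1 ≤ t → RestrictedRegression.CondSubGaussian P
      (RestrictedRegression.history X η t) (η t) σ)
    (hΓ : (Γbar - Γsb).PosSemidef)
    (hn : 9 * (k : ℝ) / α ^ 2 * (m * Real.log (27 / α)
        + 1 / 2 * Real.log (L.restrict Γbar * (L.restrict Γsb)⁻¹).det
        + Real.log q + Real.log (1 / δ)) ≤ (n : ℝ))
    -- any ordinary least squares estimator of the unrestricted parameter
    (θhat : Ω → Fin m → ℝ)
    (hθhat : ∀ ω, L.IsOLS (RestrictedRegression.dataMatrix X n ω)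
      (RestrictedRegression.dataMatrix Y n ω) (θhat ω)) :
    ∃ E : Set Ω, MeasurableSet E ∧ 1 - 3 * δ ≤ P.real E ∧ ∀ ω ∈ E,
      ‖L.toMatrix (θhat ω) - A‖ ≤ 9 * σ / α * Real.sqrt
        (RestrictedRegression.lambdaMax
            (∑ i, L.block i * (L.restrict Γsb)⁻¹ * (L.block i)ᵀ) / n *
          (12 * m * Real.log (14 / α)
            + 9 * Real.log (L.restrict Γbar * (L.restrict Γsb)⁻¹).det
            + 6 * Real.log (1 / δ))) := by
  obtain ⟨hk, hα0, hα1, hsb, -⟩ := id hbmsb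
  rcases Nat.eq_zero_or_pos m with rfl | hm
  · refine ⟨Set.univ, MeasurableSet.univ, ?_, fun ω _ => ?_⟩
    · rw [probReal_univ]
      linarith
    · have h0 : L.toMatrix (θhat ω) - A = 0 := by
        ext i j
        rw [L.toMatrix_sub_apply hA, Subsingleton.elim (θhat ω - _) 0, Matrix.mulVec_zero]
        rfl
      rw [h0, norm_zero]
      positivity
  have hR := L.restrict_posDef hsb
  have hR' := L.restrict_posDef hΓbar
  have hdet : (L.restrict Γbar * (L.restrict Γsb)⁻¹).det =
      (L.restrict Γbar).det / (L.restrict Γsb).det := by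
    rw [Matrix.det_mul, Matrix.det_nonsing_inv, Ring.inverse_eq_inv', div_eq_mul_inv]
  rw [hdet] at hn ⊢
  set D := (L.restrict Γbar).det / (L.restrict Γsb).det with hD
  have hlogD : 0 ≤ Real.log D := Real.log_nonneg
    ((one_le_div hR.det_pos).mpr (RestrictedRegression.det_le_det_of_le hR hR' (L.restrict_mono hΓ)))
  have hlogδ : 0 < Real.log (1 / δ) := Real.log_pos (by rw [lt_div_iff₀ hδ0]; linarith)
  have hlogq : 0 ≤ Real.log q := Real.log_natCast_nonneg q
  obtain ⟨hn1, hn2⟩ := RestrictedRegression.le_div_mul_of_sample_size (b := 1 / 2 * Real.log D + Real.log (1 / δ))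
    hα0 hα1 hk hm (by linarith) hlogq (le_of_eq_of_le (by ring) hn)
  have hlog27 := RestrictedRegression.one_le_log_div (a := 27) (by norm_num) hα0 hα1
  have hlog14 := RestrictedRegression.one_le_log_div (a := 14) (by norm_num) hα0 hα1
  have hm1 : (1 : ℝ) ≤ m := by exact_mod_cast hm
  have hn0 : 0 < n := by
    rcases Nat.eq_zero_or_pos n with rfl | h
    · rw [Nat.zero_div] at hn2
      push_cast at hn2
      nlinarith
    · exact h
  have hn0' : (0 : ℝ) < n := by exact_mod_cast hn0
  have hlow := RestrictedRegression.measure_exists_quad_gram_lt_le hX hη L hΓbar hΓ hbmsb hn0 hδ0 hn1 hn2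
  have hscore := RestrictedRegression.measure_exists_score_lt_le hX hη L hσ hsub hsb hΓbar hΓ hα0 hα1 hn0 hδ0
  have hmod : ∀ᵐ ω ∂P, ∀ t : Fin n, Y (t + 1) ω = A *ᵥ X (t + 1) ω + η (t + 1) ω :=
    ae_all_iff.mpr fun t => hmodel (t + 1) (by omega) (by omega)
  set B₁ := {ω | ¬ ((n : ℝ) • L.restrict Γbar - (L.design (RestrictedRegression.dataMatrix X n ω))ᵀ *
    L.design (RestrictedRegression.dataMatrix X n ω)).PosSemidef}
  set B₂ := {ω | ((n : ℝ) • L.restrict Γbar -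
      (L.design (RestrictedRegression.dataMatrix X n ω))ᵀ * L.design (RestrictedRegression.dataMatrix X n ω)).PosSemidef ∧
    ∃ w : Fin m → ℝ, w ⬝ᵥ (((L.design (RestrictedRegression.dataMatrix X n ω))ᵀ * L.design (RestrictedRegression.dataMatrix X n ω)) *ᵥ w) <
      9 / 16 * (w ⬝ᵥ (((n * α ^ 2 / 9 : ℝ) • L.restrict Γsb) *ᵥ w))}
  set B₃ := {ω | ((n : ℝ) • L.restrict Γbar -
      (L.design (RestrictedRegression.dataMatrix X n ω))ᵀ * L.design (RestrictedRegression.dataMatrix X n ω)).PosSemidef ∧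
    ∃ w : Fin m → ℝ, Real.log (1 / δ) + m * Real.log (14 / α) + 1 / 2 * Real.log D <
      w ⬝ᵥ ((L.design (RestrictedRegression.dataMatrix X n ω))ᵀ *ᵥ Matrix.vec (RestrictedRegression.dataMatrix η n ω)) -
        σ ^ 2 / 2 * (w ⬝ᵥ (((L.design (RestrictedRegression.dataMatrix X n ω))ᵀ * L.design (RestrictedRegression.dataMatrix X n ω)) *ᵥ w) +
          n * α ^ 2 / 16 * (w ⬝ᵥ (L.restrict Γsb *ᵥ w)))}
  set B₀ := {ω | ¬ ∀ t : Fin n, Y (t + 1) ω = A *ᵥ X (t + 1) ω + η (t + 1) ω}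
  set B := toMeasurable P (B₀ ∪ (B₁ ∪ (B₂ ∪ B₃))) with hB
  have hBP : P B ≤ ENNReal.ofReal (3 * δ) := by
    rw [hB, measure_toMeasurable]
    calc P (B₀ ∪ (B₁ ∪ (B₂ ∪ B₃))) ≤ P B₀ + (P B₁ + (P B₂ + P B₃)) :=
          (measure_union_le _ _).trans (add_le_add_right ((measure_union_le _ _).trans
            (add_le_add_right (measure_union_le _ _) _)) _)
      _ ≤ 0 + (ENNReal.ofReal δ + (ENNReal.ofReal δ + ENNReal.ofReal δ)) := by
          gcongr
          exact (ae_iff.mp hmod).le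
      _ = ENNReal.ofReal (3 * δ) := by
          rw [zero_add, ← ENNReal.ofReal_add hδ0.le hδ0.le, ← ENNReal.ofReal_add hδ0.le (by linarith)]
          congr 1
          ring
  have hBm : MeasurableSet B := measurableSet_toMeasurable _ _
  refine ⟨Bᶜ, hBm.compl, ?_, fun ω hω => ?_⟩
  · rw [probReal_compl_eq_one_sub hBm]
    have := ENNReal.toReal_le_of_le_ofReal (by linarith) hBP
    rw [measureReal_def]
    linarith
  have hnot : ω ∉ B₀ ∪ (B₁ ∪ (B₂ ∪ B₃)) := fun h => hω (subset_toMeasurable _ _ h)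
  simp only [Set.mem_union, not_or] at hnot
  obtain ⟨g0, g1, g2, g3⟩ := hnot
  replace g0 : ∀ t : Fin n, Y (t + 1) ω = A *ᵥ X (t + 1) ω + η (t + 1) ω := not_not.mp g0
  replace g1 := not_not.mp g1
  have g2' := fun w => not_lt.mp fun h => g2 ⟨g1, w, h⟩
  have g3' := fun w => not_lt.mp fun h => g3 ⟨g1, w, h⟩
  set Δ := θhat ω - L.Cplus *ᵥ Matrix.vec Aᵀ with hΔ
  have hbasic := L.quad_gram_le_of_isOLS hA
    (X := RestrictedRegression.dataMatrix X n ω) (Y := RestrictedRegression.dataMatrix Y n ω)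
    (H := RestrictedRegression.dataMatrix η n ω) (fun t => g0 t) (hθhat ω)
  rw [← hΔ] at hbasic
  have hquad := RestrictedRegression.quad_le_of_basic_inequality hσ hα0 hn0' hbasic
    (h := Δ ⬝ᵥ (L.restrict Γsb *ᵥ Δ))
    (K := Real.log (1 / δ) + m * Real.log (14 / α) + 1 / 2 * Real.log D)
    (by
      have := g2' Δ
      rw [RestrictedRegression.quad_smul] at this
      linarith)
    (fun c => by
      have := g3' (c • Δ)
      rw [RestrictedRegression.quad_smul_vec, RestrictedRegression.quad_smul_vec, smul_dotProduct, smul_eq_mul] at this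
      exact this)
  refine (L.norm_toMatrix_sub_le hA (θhat ω) hR hquad).trans ?_
  have hlam := RestrictedRegression.lambdaMax_nonneg (L.posSemidef_sum_block hR)
  set lam := RestrictedRegression.lambdaMax (∑ i, L.block i * (L.restrict Γsb)⁻¹ * (L.block i)ᵀ) with hlamdef
  refine Real.sqrt_le_iff.mpr ⟨by positivity, ?_⟩
  have hml : 0 ≤ m * Real.log (14 / α) := by positivity
  rw [mul_pow, Real.sq_sqrt (mul_nonneg (by positivity) (by linarith))]
  calc lam * (256 * σ ^ 2 * (Real.log (1 / δ) + m * Real.log (14 / α) + 1 / 2 * Real.log D) /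
        (n * α ^ 2))
      = σ ^ 2 / α ^ 2 * (lam / n) *
        (256 * (Real.log (1 / δ) + m * Real.log (14 / α) + 1 / 2 * Real.log D)) := by
        field_simp
    _ ≤ σ ^ 2 / α ^ 2 * (lam / n) * (81 * (12 * m * Real.log (14 / α) + 9 * Real.log D +
        6 * Real.log (1 / δ))) := by
        refine mul_le_mul_of_nonneg_left ?_ (by positivity)
        linarith
    _ = _ := by
        field_simp
        norm_num
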